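/- **Setting.** Let $G=(\mathbb V,\mathbb E)$ be a finite connected undirected simple graph on $n=|\mathbb V|$ vertices. For edge weights $w:\mathbb E\to\mathbb R$ let $d_{(G,w)}(u,v)$ be the minimum of $\sum_{e\in P}w(e)$ over all simple paths $P$ from $u$ to $v$ in $G$. Two weightings $w,w'$ of $G$ are *neighboring* if $\sum_{e\in\mathbb E}|w(e)-w'(e)|\le 1$. A randomized algorithm $\mathbb A$ is *$(\epsilon,\delta)$-differentially private* w.r.t. the weights if $\Pr[\mathbb A(w)\in O]\le e^{\epsilon}\Pr[\mathbb A(w')\in O]+\delta$ for all neighboring $w,w'$ and all measurable sets $O$ of outputs. $\mathrm{Lap}(\mu,b)$ is the distribution on $\mathbb R$ with density $\frac1{2b}e^{-|x-\mu|/b}$. **Algorithm 1** (input $G,w,\epsilon,\delta,\gamma$). Put $\epsilon'=\epsilon/2$. 1. Draw a set $\mathbb V_1\subseteq\mathbb V$ of $s$ vertices uniformly at random, where $s$ is $n^{1/2}$ rounded to an integer ($s=\lfloor\sqrt n\rfloor$ or $s=\lceil\sqrt n\rceil$). 2. Let $\mathbb E_1=\{\{u,v\}:u,v\in\mathbb V_1,\,u\ne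 v\}$ and $\mathbb E_0=\mathbb E\setminus\mathbb E_1$. Put $$\sigma_1=\frac{2\sqrt2\,n^{1/2}\sqrt{\log(1/\delta)}}{\epsilon'},\quad \mu_1=\sigma_1\log(n/\gamma),\qquad \sigma_0=\frac1{\epsilon'},\quad \mu_0=\sigma_0\log(n^2/\gamma).$$ 3. With independent noise variables $X_e$, where $X_e\sim\mathrm{Lap}(\mu_1,\sigma_1)$ for $e\in\mathbb E_1$ and $X_e\sim\mathrm{Lap}(\mu_0,\sigma_0)$ for $e\in\mathbb E_0$, set $w'(e)=d_{(G,w)}(u,v)+X_e$ for $e=\{u,v\}\in\mathbb E_1$ and $w'(e)=w(e)+X_e$ for $e\in\mathbb E_0$. 4. Publish the synthetic weighted graph $G'=(\mathbb V,\mathbb E_0\cup\mathbb E_1,w')$. The estimated distance $\hat d(u,v)$ is the shortest-path distance between $u$ and $v$ in $G'$. **Theorem.** There is an absolute constant $C>0$ such that for every $G$ as above, either rounding $s$ of $n^{1/2}$, and all $\epsilon>0$, $0<\delta\le\frac12$, $0<\gamma<1$: 1. if $\epsilon<2$, then Algorithm 1, which publishes $G'$, is $(\epsilon,\delta)$-differentially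 private w.r.t. the weights (over all real weightings of $G$); 2. for every nonnegative weighting $w$ of $G$, with probability at least $1-4\gamma$, $$|\hat d(u,v)-d_{(G,w)}(u,v)|\le C\,\epsilon^{-1}n^{1/2}\log^2(n/\gamma)\sqrt{\log(1/\delta)}\qquad\text{for all }u,v\in\mathbb V.$$ -/

import Mathlib

open MeasureTheory
open scoped ENNReal

noncomputable section

/-- The Laplace distribution on `ℝ` with location `μ` and scale `b > 0`, i.e. the measure with
density `x ↦ exp (-|x - μ| / b) / (2 b)`. -/
def laplaceMeasure (μ b : ℝ) : Measure ℝ :=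
  volume.withDensity fun x => ENNReal.ofReal (1 / (2 * b) * Real.exp (-|x - μ| / b))

namespace SimpleGraph

variable {V : Type*}

/-- Total weight of a walk. Edge weights are functions on `Sym2 V`; only the values on the edges
of the graph under consideration ever matter. -/
def walkWeight {G : SimpleGraph V} (w : Sym2 V → ℝ) {u v : V} (p : G.Walk u v) : ℝ :=
  (p.edges.map w).sum

/-- Weighted shortest-path distance: the least total weight of a (simple) path from `u` to `v`.
For a finite connected graph there are finitely many such paths, and at least one, so the
infimum is a minimum, also if some weights are negative. -/
def wdist (G : SimpleGraph V) (w : Sym2 V → ℝ) (u v : V) : ℝ :=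
  ⨅ p : G.Path u v, walkWeight w p.1

theorem wdist_comm (G : SimpleGraph V) (w : Sym2 V → ℝ) (u v : V) :
    wdist G w u v = wdist G w v u := by
  let e : G.Path u v ≃ G.Path v u :=
    { toFun := Path.reverse
      invFun := Path.reverse
      left_inv := fun p => Subtype.ext (Walk.reverse_reverse p.1)
      right_inv := fun p => Subtype.ext (Walk.reverse_reverse p.1) }
  refine Equiv.iInf_congr e fun p => ?_
  change walkWeight w p.1.reverse = walkWeight w p.1
  simp [walkWeight, Walk.edges_reverse, List.sum_reverse]

/-- `wdist` as a function of the unordered pair of endpoints. -/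
def wdistSym2 (G : SimpleGraph V) (w : Sym2 V → ℝ) : Sym2 V → ℝ :=
  Sym2.lift ⟨wdist G w, wdist_comm G w⟩

/-- The shortcut graph `(V, E₁)`: all pairs of distinct vertices of `V₁`. -/
def shortcutGraph (V₁ : Finset V) : SimpleGraph V where
  Adj u v := u ∈ V₁ ∧ v ∈ V₁ ∧ u ≠ v
  symm := ⟨fun _ _ h => ⟨h.2.1, h.1, h.2.2.symm⟩⟩
  loopless := ⟨fun _ h => h.2.2 rfl⟩

/-- A published synthetic graph: its topology together with its edge weights (set to `0` at
pairs that are not edges). -/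
abbrev WeightedGraph (V : Type*) : Type _ := SimpleGraph V × (Sym2 V → ℝ)

open Classical in
/-- The synthetic graph `G' = (V, E₀ ∪ E₁, w')` built from the weighted graph `(G, w)`, the sampled
vertex set `V₁` and the noise `X`, where `E₁` is the set of shortcut edges and `E₀ = E \ E₁`:
`w' e = APSP e + X e` for `e ∈ E₁` and `w' e = w e + X e` for `e ∈ E₀`. -/
def syntheticGraph (G : SimpleGraph V) (w : Sym2 V → ℝ) (V₁ : Finset V) (X : Sym2 V → ℝ) :
    WeightedGraph V :=
  (G ⊔ shortcutGraph V₁, fun e =>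
    if e ∈ (shortcutGraph V₁).edgeSet then wdistSym2 G w e + X e
    else if e ∈ G.edgeSet then w e + X e
    else 0)

variable [Fintype V]

/-- Scale of the noise on the shortcut edges: `2 √2 √n √(log (1/δ)) / ε'` with `ε' = ε / 2`. -/
def shortcutScale (n : ℕ) (ε δ : ℝ) : ℝ :=
  2 * √2 * √(n : ℝ) * √(Real.log (1 / δ)) / (ε / 2)

/-- Scale of the noise on the remaining original edges: `1 / ε'` with `ε' = ε / 2`. -/
def edgeScale (ε : ℝ) : ℝ := 1 / (ε / 2)

open Classical in
/-- The law of the noise `X` given `V₁`: independent coordinates, `Lap(μ₁, σ₁)` with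
`μ₁ = σ₁ log (n / γ)` on `E₁` and `Lap(μ₀, σ₀)` with `μ₀ = σ₀ log (n² / γ)` elsewhere.
(The coordinates at pairs that are not edges of the synthetic graph are never used.) -/
def noiseLaw (V₁ : Finset V) (ε δ γ : ℝ) : Measure (Sym2 V → ℝ) :=
  let n := Fintype.card V
  Measure.pi fun e =>
    if e ∈ (shortcutGraph V₁).edgeSet then
      laplaceMeasure (shortcutScale n ε δ * Real.log (n / γ)) (shortcutScale n ε δ)
    else
      laplaceMeasure (edgeScale ε * Real.log ((n : ℝ) ^ 2 / γ)) (edgeScale ε)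

/-- The law of the synthetic graph published by the algorithm on input `(G, w)`: first a set `V₁`
of `s` vertices is drawn uniformly at random, then the noise is drawn from `noiseLaw V₁`. -/
def privateAPSP (G : SimpleGraph V) (s : ℕ) (ε δ γ : ℝ) (w : Sym2 V → ℝ) :
    Measure (WeightedGraph V) :=
  ((Finset.univ.powersetCard s : Finset (Finset V)).card : ℝ≥0∞)⁻¹ •
    ∑ V₁ ∈ (Finset.univ.powersetCard s : Finset (Finset V)),
      (noiseLaw V₁ ε δ γ).map (syntheticGraph G w V₁)

open Classical in
/-- Two weightings of `G` are neighboring if they differ by at most `1` in `ℓ¹` norm. -/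
def Neighboring (G : SimpleGraph V) (w w' : Sym2 V → ℝ) : Prop :=
  ∑ e ∈ G.edgeFinset, |w e - w' e| ≤ 1

/-- `(ε, δ)`-differential privacy, with respect to the edge weights of the public graph `G`, of a
randomized algorithm `A`, given by the law `A w` of its output for each input weighting `w`. -/
def IsDP {O : Type*} [MeasurableSpace O] (G : SimpleGraph V) (ε δ : ℝ)
    (A : (Sym2 V → ℝ) → Measure O) : Prop :=
  ∀ w w' : Sym2 V → ℝ, Neighboring G w w' → ∀ S : Set O, MeasurableSet S →
    A w S ≤ ENNReal.ofReal (Real.exp ε) * A w' S + ENNReal.ofReal δ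

end SimpleGraph

end

/-! Privacy. Fix the sample `V₁`. The output is a post-processing (`publish`) of independent Laplace
variables, and changing `w` only translates them. A distance moves by at most 1 between neighboring
weightings, and there are at most `s.choose 2 ≤ n` shortcut edges, so each of these coordinates
moves by at most `1 / σ₁` scales. The remaining coordinates move by at most `ε / 2` scales
altogether, a loss bounded outright by `ε / 2`. On the shortcut edges the privacy loss is a sum of
independent bounded terms of mean at most `(1 / σ₁) ^ 2`, and a Chernoff bound shows that it reaches
`ε / 2` with probability at most `δ` (`pi_laplaceMeasure_add_apply_le`, `exp_privacyLoss_le`). The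
law of `V₁` ignores `w`, so averaging over `V₁` preserves the inequality.

Accuracy. The positive means make all noise lie in `[0, 2μ]` with probability at least `1 - 2γ`.
Then no edge of the synthetic graph is lighter than the true distance of its ends, so distances are
never underestimated. Fix a shortest path for each pair. With probability at least `1 - 2γ`, the
sample meets the first and the last `L ≈ 2√n log(n²/γ)` vertices of each path having that many
(`card_filter_not_hitsPrefix_le`). Jumping from the first to the last sampled vertex of the path
costs one shortcut noise and at most `2L` edge noises, hence an error of at most `2L · 2μ₀ + 2μ₁`
(`abs_wdist_syntheticGraph_sub_wdist_le`). -/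

open ProbabilityTheory

/-! ### Laplace distributions: tails, translations, density ratios -/

theorem measurable_laplaceDensity (μ b : ℝ) :
    Measurable fun x : ℝ => ENNReal.ofReal (1 / (2 * b) * Real.exp (-|x - μ| / b)) := by
  fun_prop

theorem laplaceMeasure_Ioi (μ : ℝ) {b c : ℝ} (hb : 0 < b) (hc : 0 ≤ c) :
    laplaceMeasure μ b (Set.Ioi (μ + c)) = ENNReal.ofReal (1 / 2 * Real.exp (-(c / b))) := by
  have hneg : -b⁻¹ < 0 := by simpa using hb
  have hcongr : Set.EqOn (fun x => 1 / (2 * b) * Real.exp (-|x - μ| / b))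
      (fun x => 1 / (2 * b) * Real.exp (μ / b) * Real.exp (-b⁻¹ * x)) (Set.Ioi (μ + c)) := by
    intro x hx
    have hx' : 0 ≤ x - μ := by have := Set.mem_Ioi.1 hx; linarith
    simp only [abs_of_nonneg hx']
    rw [mul_assoc, ← Real.exp_add]
    congr 2
    field_simp
    ring
  rw [laplaceMeasure, withDensity_apply _ measurableSet_Ioi,
    ← ofReal_integral_eq_lintegral_ofReal]
  · rw [setIntegral_congr_fun measurableSet_Ioi hcongr, integral_const_mul,
      integral_exp_mul_Ioi hneg]
    congr 1
    have : Real.exp (-(c / b)) = Real.exp (μ / b) * Real.exp (-b⁻¹ * (μ + c)) := by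
      rw [← Real.exp_add]; congr 1; field_simp; ring
    rw [this]
    field_simp
  · exact IntegrableOn.congr_fun ((integrableOn_exp_mul_Ioi hneg _).const_mul _) hcongr.symm
      measurableSet_Ioi
  · exact ae_of_all _ fun x => by positivity

theorem laplaceMeasure_Iic (μ : ℝ) {b c : ℝ} (hb : 0 < b) (hc : 0 ≤ c) :
    laplaceMeasure μ b (Set.Iic (μ - c)) = ENNReal.ofReal (1 / 2 * Real.exp (-(c / b))) := by
  have hpos : 0 < b⁻¹ := by simpa using hb
  have hcongr : Set.EqOn (fun x => 1 / (2 * b) * Real.exp (-|x - μ| / b))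
      (fun x => 1 / (2 * b) * Real.exp (-(μ / b)) * Real.exp (b⁻¹ * x)) (Set.Iic (μ - c)) := by
    intro x hx
    have hx' : x - μ ≤ 0 := by have := Set.mem_Iic.1 hx; linarith
    simp only [abs_of_nonpos hx']
    rw [mul_assoc, ← Real.exp_add]
    congr 2
    field_simp
    ring
  rw [laplaceMeasure, withDensity_apply _ measurableSet_Iic,
    ← ofReal_integral_eq_lintegral_ofReal]
  · rw [setIntegral_congr_fun measurableSet_Iic hcongr, integral_const_mul,
      integral_exp_mul_Iic hpos]
    congr 1
    have : Real.exp (-(c / b)) = Real.exp (-(μ / b)) * Real.exp (b⁻¹ * (μ - c)) := by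
      rw [← Real.exp_add]; congr 1; field_simp; ring
    rw [this]
    field_simp
  · exact IntegrableOn.congr_fun ((integrableOn_exp_mul_Iic hpos _).const_mul _) hcongr.symm
      measurableSet_Iic
  · exact ae_of_all _ fun x => by positivity

theorem isProbabilityMeasure_laplaceMeasure (μ : ℝ) {b : ℝ} (hb : 0 < b) :
    IsProbabilityMeasure (laplaceMeasure μ b) := by
  constructor
  have h1 := laplaceMeasure_Ioi μ hb le_rfl
  have h2 := laplaceMeasure_Iic μ hb le_rfl
  simp only [add_zero, sub_zero, zero_div, neg_zero, Real.exp_zero, mul_one] at h1 h2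
  rw [← Set.Iic_union_Ioi (a := μ), measure_union (Set.Iic_disjoint_Ioi le_rfl) measurableSet_Ioi,
    h1, h2, ← ENNReal.ofReal_add (by norm_num) (by norm_num)]
  norm_num

theorem laplaceMeasure_lt_abs_sub_le (μ : ℝ) {b c : ℝ} (hb : 0 < b) (hc : 0 ≤ c) :
    laplaceMeasure μ b {x | c < |x - μ|} ≤ ENNReal.ofReal (Real.exp (-(c / b))) := by
  have hsub : {x : ℝ | c < |x - μ|} ⊆ Set.Iic (μ - c) ∪ Set.Ioi (μ + c) := by
    intro x hx
    rcases lt_abs.1 (show c < |x - μ| from hx) with h | h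
    · right; simp only [Set.mem_Ioi]; linarith
    · left; simp only [Set.mem_Iic]; linarith
  refine (measure_mono hsub).trans ((measure_union_le _ _).trans ?_)
  rw [laplaceMeasure_Iic μ hb hc, laplaceMeasure_Ioi μ hb hc,
    ← ENNReal.ofReal_add (by positivity) (by positivity)]
  exact ENNReal.ofReal_le_ofReal (by linarith)

theorem laplaceMeasure_map_add_const (μ b c : ℝ) :
    (laplaceMeasure μ b).map (· + c) = laplaceMeasure (μ + c) b := by
  ext s hs
  have hm : Measurable fun x : ℝ => x + c := by fun_prop
  rw [Measure.map_apply hm hs, laplaceMeasure, laplaceMeasure, withDensity_apply _ (hm hs),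
    withDensity_apply _ hs, ← lintegral_indicator (hm hs), ← lintegral_indicator hs,
    ← lintegral_add_right_eq_self (s.indicator _) c]
  refine lintegral_congr fun x => ?_
  by_cases h : x + c ∈ s
  · rw [Set.indicator_of_mem (show x ∈ (fun x => x + c) ⁻¹' s from h), Set.indicator_of_mem h]
    congr 6
    ring
  · rw [Set.indicator_of_notMem (show x ∉ (fun x => x + c) ⁻¹' s from h),
      Set.indicator_of_notMem h]

/-- The exponent is the privacy loss of a single coordinate; by the triangle inequality it is at
most `|c| / b` in absolute value. -/
theorem laplaceMeasure_add_eq_withDensity (μ b c : ℝ) :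
    laplaceMeasure (μ + c) b = (laplaceMeasure μ b).withDensity fun x =>
      ENNReal.ofReal (Real.exp ((|x - μ| - |x - (μ + c)|) / b)) := by
  rw [laplaceMeasure, laplaceMeasure, ← withDensity_mul _ (measurable_laplaceDensity μ b)
    (by fun_prop)]
  congr 1
  funext x
  rw [Pi.mul_apply, ← ENNReal.ofReal_mul' (by positivity), mul_assoc, ← Real.exp_add]
  congr 3
  ring

/-! ### Privacy loss of product measures and advanced composition -/

theorem MeasureTheory.Measure.pi_withDensity {ι : Type*} [Fintype ι] {α : ι → Type*}
    [∀ i, MeasurableSpace (α i)] (μ : ∀ i, Measure (α i)) [∀ i, IsProbabilityMeasure (μ i)]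
    {f : ∀ i, α i → ℝ≥0∞} (hf : ∀ i, Measurable (f i))
    [∀ i, SigmaFinite ((μ i).withDensity (f i))] :
    Measure.pi (fun i => (μ i).withDensity (f i)) =
      (Measure.pi μ).withDensity fun x => ∏ i, f i (x i) := by
  refine Measure.pi_eq fun s hs => ?_
  rw [withDensity_apply _ (MeasurableSet.univ_pi hs),
    ← lintegral_indicator (MeasurableSet.univ_pi hs)]
  have hind : ∀ x : ∀ i, α i, (Set.univ.pi s).indicator (fun x => ∏ i, f i (x i)) x =
      ∏ i, (s i).indicator (f i) (x i) := by
    intro x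
    by_cases hx : x ∈ Set.univ.pi s
    · rw [Set.indicator_of_mem hx]
      exact Finset.prod_congr rfl fun i _ =>
        (Set.indicator_of_mem (hx i (Set.mem_univ i)) (f i)).symm
    · rw [Set.indicator_of_notMem hx]
      simp only [Set.mem_univ_pi, not_forall] at hx
      obtain ⟨i, hi⟩ := hx
      exact (Finset.prod_eq_zero (Finset.mem_univ i) (Set.indicator_of_notMem hi _)).symm
  have hmeas : ∀ i, Measurable ((s i).indicator (f i)) := fun i => (hf i).indicator (hs i)
  simp_rw [hind]
  rw [lintegral_prod_eq_prod_lintegral_of_indepFun Finset.univ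
    (fun i (x : ∀ i, α i) => (s i).indicator (f i) (x i))
    (iIndepFun_pi fun i => (hmeas i).aemeasurable)
    fun i => (hmeas i).comp (measurable_pi_apply i)]
  refine Finset.prod_congr rfl fun i _ => ?_
  rw [withDensity_apply _ (hs i), ← lintegral_indicator (hs i),
    ← (measurePreserving_eval μ i).lintegral_comp (hmeas i)]

/-- Where the loss `L` is below `ε` the density is at most `exp ε`; the rest of `T` is charged to
the probability of a large loss, measured under the shifted law. -/
theorem MeasureTheory.withDensity_exp_apply_le {α : Type*} [MeasurableSpace α] (μ : Measure α)
    {L : α → ℝ} (hL : Measurable L) (ε : ℝ) {T : Set α} (hT : MeasurableSet T) :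
    μ.withDensity (fun x => ENNReal.ofReal (Real.exp (L x))) T ≤
      ENNReal.ofReal (Real.exp ε) * μ T +
        μ.withDensity (fun x => ENNReal.ofReal (Real.exp (L x))) {x | ε ≤ L x} := by
  have hlt : MeasurableSet {x | L x < ε} := measurableSet_lt hL measurable_const
  have hsub : T ⊆ (T ∩ {x | L x < ε}) ∪ {x | ε ≤ L x} := fun x hx =>
    (lt_or_ge (L x) ε).imp (fun h => ⟨hx, h⟩) id
  refine (measure_mono hsub).trans ((measure_union_le _ _).trans (add_le_add_left ?_ _))
  rw [withDensity_apply _ (hT.inter hlt)]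
  calc ∫⁻ x in T ∩ {x | L x < ε}, ENNReal.ofReal (Real.exp (L x)) ∂μ
      ≤ ∫⁻ _ in T ∩ {x | L x < ε}, ENNReal.ofReal (Real.exp ε) ∂μ :=
        setLIntegral_mono measurable_const fun x hx =>
          ENNReal.ofReal_le_ofReal (Real.exp_le_exp.2 hx.2.le)
    _ ≤ ENNReal.ofReal (Real.exp ε) * μ T := by
        rw [setLIntegral_const]
        gcongr
        exact Set.inter_subset_left

/-- A bounded privacy loss `X`, that is, one with `𝔼[exp (-X)] = 1`, has a small mean and is
subgaussian around it. -/
theorem mgf_le_of_integral_exp_neg_eq_one {Ω : Type*} [MeasurableSpace Ω] (P : Measure Ω)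
    [IsProbabilityMeasure P] {X : Ω → ℝ} (hX : Measurable X) {η t : ℝ} (hη : η ≤ 1)
    (hbound : ∀ ω, |X ω| ≤ η) (hone : ∫ ω, Real.exp (-X ω) ∂P = 1) (ht : 0 ≤ t) :
    mgf X P t ≤ Real.exp ((t + t ^ 2 / 2) * η ^ 2) := by
  have hIcc : ∀ᵐ ω ∂P, X ω ∈ Set.Icc (-η) η := ae_of_all _ fun ω => abs_le.1 (hbound ω)
  have hint : Integrable X P := Integrable.of_mem_Icc _ _ hX.aemeasurable hIcc
  have hintexp : Integrable (fun ω => Real.exp (-X ω)) P := by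
    simpa using integrable_exp_mul_of_mem_Icc (t := -1) hX.aemeasurable hIcc
  -- For `|x| ≤ 1`, `exp (-x) ≤ 1 - x + x ^ 2`; integrating gives `1 ≤ 1 - 𝔼 X + η ^ 2`.
  have hmean : P[X] ≤ η ^ 2 := by
    have hle : ∫ ω, Real.exp (-X ω) ∂P ≤ ∫ ω, (1 - X ω + η ^ 2) ∂P := by
      refine integral_mono hintexp (((integrable_const _).sub hint).add (integrable_const _)) ?_
      intro ω
      have h1 := (abs_le.1 (Real.abs_exp_sub_one_sub_id_le (x := -X ω)
        (by rw [abs_neg]; exact (hbound ω).trans hη))).2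
      have h2 : (X ω) ^ 2 ≤ η ^ 2 := sq_le_sq' (abs_le.1 (hbound ω)).1 (abs_le.1 (hbound ω)).2
      dsimp only
      nlinarith
    have hint' : Integrable (fun ω => 1 - X ω) P := (integrable_const _).sub hint
    rw [hone, integral_add hint' (integrable_const _), integral_sub (integrable_const _) hint]
      at hle
    simp only [integral_const, probReal_univ, smul_eq_mul, one_mul] at hle
    linarith
  have hsub := (hasSubgaussianMGF_of_mem_Icc hX.aemeasurable hIcc).mgf_le t
  have hη0 : 0 ≤ η := by
    have := P.nonempty_of_neZero
    exact (abs_nonneg _).trans (hbound (Classical.arbitrary Ω))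
  -- The variance proxy in Hoeffding's lemma is the squared half-length of `[-η, η]`.
  have hcoe : (((‖η - -η‖₊ / 2) ^ 2 : NNReal) : ℝ) = η ^ 2 := by
    push_cast
    rw [Real.norm_eq_abs, abs_of_nonneg (by linarith)]
    ring
  rw [hcoe] at hsub
  have hsplit : mgf X P t = Real.exp (t * P[X]) * mgf (fun ω => X ω - P[X]) P t := by
    rw [mgf, mgf, ← integral_const_mul]
    refine integral_congr_ae (ae_of_all _ fun ω => ?_)
    dsimp only
    rw [← Real.exp_add]
    congr 1
    ring
  rw [hsplit]
  refine (mul_le_mul_of_nonneg_left hsub (Real.exp_nonneg _)).trans ?_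
  rw [← Real.exp_add, Real.exp_le_exp]
  nlinarith [mul_le_mul_of_nonneg_left hmean ht]

/-- Chernoff's bound: by independence the moment generating function of the sum is a product, each
factor being controlled by `mgf_le_of_integral_exp_neg_eq_one`. -/
theorem pi_measure_le_sum_le {ι : Type*} [Fintype ι] (P : ι → Measure ℝ)
    [∀ i, IsProbabilityMeasure (P i)] {X : ι → ℝ → ℝ} (hX : ∀ i, Measurable (X i))
    (A : Finset ι) {η t : ℝ} (hη : η ≤ 1) (hbound : ∀ i ∈ A, ∀ x, |X i x| ≤ η)
    (hone : ∀ i ∈ A, ∫ x, Real.exp (-X i x) ∂P i = 1) (ht : 0 ≤ t) (ε : ℝ) :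
    (Measure.pi P).real {x | ε ≤ ∑ i ∈ A, X i (x i)} ≤
      Real.exp (-t * ε + A.card * ((t + t ^ 2 / 2) * η ^ 2)) := by
  have hm : ∀ i, Measurable fun x : ι → ℝ => X i (x i) := fun i =>
    (hX i).comp (measurable_pi_apply i)
  have hsum : Measurable fun x : ι → ℝ => ∑ i ∈ A, X i (x i) :=
    Finset.measurable_fun_sum A fun i _ => hm i
  have hIcc : ∀ᵐ x ∂Measure.pi P,
      (∑ i ∈ A, X i (x i)) ∈ Set.Icc (-(A.card * η)) (A.card * η) := by
    refine ae_of_all _ fun x => abs_le.1 ((Finset.abs_sum_le_sum_abs _ _).trans ?_)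
    refine (Finset.sum_le_card_nsmul A _ η fun i hi => hbound i hi (x i)).trans ?_
    rw [nsmul_eq_mul]
  refine (measure_ge_le_exp_mul_mgf ε ht
    (integrable_exp_mul_of_mem_Icc hsum.aemeasurable hIcc)).trans ?_
  have hind : iIndepFun (fun i (x : ι → ℝ) => X i (x i)) (Measure.pi P) :=
    iIndepFun_pi fun i => (hX i).aemeasurable
  have hmgf : mgf (fun x : ι → ℝ => ∑ i ∈ A, X i (x i)) (Measure.pi P) t ≤
      Real.exp (A.card * ((t + t ^ 2 / 2) * η ^ 2)) := by
    have h := hind.mgf_sum (t := t) hm A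
    have hfun : (∑ i ∈ A, fun x : ι → ℝ => X i (x i)) = fun x => ∑ i ∈ A, X i (x i) := by
      ext x; simp
    rw [hfun] at h
    rw [h, Real.exp_nat_mul, ← Finset.prod_const]
    refine Finset.prod_le_prod (fun i _ => mgf_nonneg) fun i hi => ?_
    have heval : mgf (fun x : ι → ℝ => X i (x i)) (Measure.pi P) t = mgf (X i) (P i) t :=
      integral_comp_eval (μ := P) (i := i) (f := fun y => Real.exp (t * X i y))
        ((hX i).const_mul t).exp.aestronglyMeasurable
    rw [heval]
    exact mgf_le_of_integral_exp_neg_eq_one _ (hX i) hη (hbound i hi) (hone i hi) ht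
  rw [Real.exp_add]
  gcongr

theorem integral_exp_neg_withDensity_exp {α : Type*} [MeasurableSpace α] (μ : Measure α)
    [IsProbabilityMeasure μ] {L : α → ℝ} (hL : Measurable L) :
    ∫ x, Real.exp (-L x) ∂μ.withDensity (fun x => ENNReal.ofReal (Real.exp (L x))) = 1 := by
  rw [integral_withDensity_eq_integral_toReal_smul (by fun_prop)
    (ae_of_all _ fun x => ENNReal.ofReal_lt_top)]
  have : ∀ x, (ENNReal.ofReal (Real.exp (L x))).toReal • Real.exp (-L x) = 1 := fun x => by
    rw [ENNReal.toReal_ofReal (Real.exp_nonneg _), smul_eq_mul, ← Real.exp_add, add_neg_cancel,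
      Real.exp_zero]
  simp_rw [this]
  simp

theorem abs_abs_sub_abs_sub_add_div_le (x m c : ℝ) {b : ℝ} (hb : 0 < b) :
    |(|x - m| - |x - (m + c)|) / b| ≤ |c| / b := by
  rw [abs_div, abs_of_pos hb]
  refine div_le_div_of_nonneg_right ?_ hb.le
  have h := abs_abs_sub_abs_le (x - m) (x - (m + c))
  rwa [show x - m - (x - (m + c)) = c by ring] at h

/-- Advanced composition for independent Laplace mechanisms: translating a product of Laplace
distributions by `c`, where the coordinates in `A` are moved by at most `η` scales each, and the
others by at most `ε₀` scales altogether. -/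
theorem pi_laplaceMeasure_add_apply_le {ι : Type*} [Fintype ι] [DecidableEq ι] (m b c : ι → ℝ)
    (hb : ∀ i, 0 < b i) (A : Finset ι) {η ε₀ t : ℝ} (hη : η ≤ 1) (hA : ∀ i ∈ A, |c i| / b i ≤ η)
    (hAc : ∑ i ∈ Aᶜ, |c i| / b i ≤ ε₀) (ht : 0 ≤ t) (ε₁ : ℝ) {T : Set (ι → ℝ)}
    (hT : MeasurableSet T) :
    Measure.pi (fun i => laplaceMeasure (m i + c i) (b i)) T ≤
      ENNReal.ofReal (Real.exp (ε₀ + ε₁)) * Measure.pi (fun i => laplaceMeasure (m i) (b i)) T +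
        ENNReal.ofReal (Real.exp (-t * ε₁ + A.card * ((t + t ^ 2 / 2) * η ^ 2))) := by
  set ℓ : ι → ℝ → ℝ := fun i x => (|x - m i| - |x - (m i + c i)|) / b i with hℓ
  have hℓm : ∀ i, Measurable (ℓ i) := fun i => by simp only [hℓ]; fun_prop
  have : ∀ i, IsProbabilityMeasure (laplaceMeasure (m i) (b i)) := fun i =>
    isProbabilityMeasure_laplaceMeasure _ (hb i)
  have : ∀ i, IsProbabilityMeasure (laplaceMeasure (m i + c i) (b i)) := fun i =>
    isProbabilityMeasure_laplaceMeasure _ (hb i)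
  have hdens : ∀ i, laplaceMeasure (m i + c i) (b i) =
      (laplaceMeasure (m i) (b i)).withDensity fun x => ENNReal.ofReal (Real.exp (ℓ i x)) :=
    fun i => laplaceMeasure_add_eq_withDensity _ _ _
  have : ∀ i, IsProbabilityMeasure
      ((laplaceMeasure (m i) (b i)).withDensity fun x => ENNReal.ofReal (Real.exp (ℓ i x))) :=
    fun i => hdens i ▸ inferInstance
  have hpi : Measure.pi (fun i => laplaceMeasure (m i + c i) (b i)) =
      (Measure.pi fun i => laplaceMeasure (m i) (b i)).withDensity fun x =>
        ENNReal.ofReal (Real.exp (∑ i, ℓ i (x i))) := by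
    simp_rw [hdens]
    rw [Measure.pi_withDensity _ fun i => by have := hℓm i; fun_prop]
    congr 1
    funext x
    rw [Real.exp_sum, ENNReal.ofReal_prod_of_nonneg fun i _ => Real.exp_nonneg _]
  have hbound : ∀ i x, |ℓ i x| ≤ |c i| / b i := fun i x =>
    abs_abs_sub_abs_sub_add_div_le x (m i) (c i) (hb i)
  have htail := pi_measure_le_sum_le (fun i => laplaceMeasure (m i + c i) (b i)) hℓm A hη
    (fun i hi x => (hbound i x).trans (hA i hi))
    (fun i _ => by rw [hdens]; exact integral_exp_neg_withDensity_exp _ (hℓm i)) ht ε₁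
  have hmeas : Measurable fun x : ι → ℝ => ∑ i, ℓ i (x i) :=
    Finset.measurable_fun_sum _ fun i _ => (hℓm i).comp (measurable_pi_apply i)
  have hmain := withDensity_exp_apply_le (Measure.pi fun i => laplaceMeasure (m i) (b i)) hmeas
    (ε₀ + ε₁) hT
  rw [← hpi] at hmain
  refine hmain.trans (add_le_add_right ?_ _)
  rw [← ENNReal.ofReal_toReal (measure_ne_top (Measure.pi fun i => laplaceMeasure (m i + c i) (b i))
    {x | ε₀ + ε₁ ≤ ∑ i, ℓ i (x i)})]
  refine ENNReal.ofReal_le_ofReal (le_trans ?_ htail)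
  refine measureReal_mono fun x hx => ?_
  -- The coordinates outside `A` contribute at most `ε₀` for every outcome, so a total loss of `ε₀ +
  -- ε₁` forces a loss of `ε₁` on `A`.
  have hsplit := Finset.sum_add_sum_compl A fun i => ℓ i (x i)
  have hrest : ∑ i ∈ Aᶜ, ℓ i (x i) ≤ ε₀ :=
    (Finset.sum_le_sum fun i _ => (le_abs_self _).trans (hbound i (x i))).trans hAc
  have hx' : ε₀ + ε₁ ≤ ∑ i, ℓ i (x i) := hx
  show ε₁ ≤ ∑ i ∈ A, ℓ i (x i)
  linarith

/-! ### Sensitivity of distances and number of shortcut edges -/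

namespace SimpleGraph

theorem Connected.nonempty_path {V : Type*} {G : SimpleGraph V} (hG : G.Connected) (u v : V) :
    Nonempty (G.Path u v) := by
  classical exact ⟨(hG.preconnected u v).some.toPath⟩

theorem finite_path {V : Type*} [Finite V] (G : SimpleGraph V) (u v : V) :
    Finite (G.Path u v) := by
  classical
  have := Fintype.ofFinite V
  infer_instance

theorem wdist_le_walkWeight_path {V : Type*} [Finite V] (G : SimpleGraph V) (w : Sym2 V → ℝ)
    {u v : V} (p : G.Path u v) : wdist G w u v ≤ walkWeight w p.1 := by
  have := finite_path G u v
  exact ciInf_le (Set.finite_range _).bddBelow p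

theorem exists_path_walkWeight_eq_wdist {V : Type*} [Finite V] {G : SimpleGraph V}
    (hG : G.Connected) (w : Sym2 V → ℝ) (u v : V) :
    ∃ p : G.Path u v, walkWeight w p.1 = wdist G w u v := by
  have := finite_path G u v
  have := hG.nonempty_path u v
  exact exists_eq_ciInf_of_finite

theorem wdist_self {V : Type*} (G : SimpleGraph V) (w : Sym2 V → ℝ) (u : V) :
    wdist G w u u = 0 := by
  have h : ∀ p : G.Path u u, walkWeight w p.1 = 0 := fun p => by
    rw [p.loop_eq]; simp [walkWeight, Path.nil]
  have : Nonempty (G.Path u u) := ⟨Path.nil⟩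
  simp [wdist, h]

open Classical in
theorem abs_walkWeight_sub_walkWeight_le {V : Type*} [Fintype V] {G : SimpleGraph V}
    (w w' : Sym2 V → ℝ) {u v : V} (p : G.Path u v) :
    |walkWeight w p.1 - walkWeight w' p.1| ≤ ∑ e ∈ G.edgeFinset, |w e - w' e| := by
  -- A path repeats no edge, so each weight change is counted at most once.
  have hnd := p.2.isTrail.edges_nodup
  have hsum : ∀ f : Sym2 V → ℝ, (p.1.edges.map f).sum = ∑ e ∈ p.1.edges.toFinset, f e :=
    fun f => (List.sum_toFinset f hnd).symm
  rw [walkWeight, walkWeight, hsum, hsum, ← Finset.sum_sub_distrib]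
  refine (Finset.abs_sum_le_sum_abs _ _).trans ?_
  refine Finset.sum_le_sum_of_subset_of_nonneg (fun e he => ?_) fun e _ _ => abs_nonneg _
  rw [mem_edgeFinset]
  exact p.1.edges_subset_edgeSet (List.mem_toFinset.1 he)

open Classical in
-- A shortest path for `w'` is a competitor for `w`. No sign condition on the weights is needed,
-- since the minimum runs over paths.
theorem wdist_le_wdist_add {V : Type*} [Fintype V] {G : SimpleGraph V} (hG : G.Connected)
    (w w' : Sym2 V → ℝ) (u v : V) :
    wdist G w u v ≤ wdist G w' u v + ∑ e ∈ G.edgeFinset, |w e - w' e| := by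
  obtain ⟨p, hp⟩ := exists_path_walkWeight_eq_wdist hG w' u v
  have h1 := wdist_le_walkWeight_path G w p
  have h2 := (abs_le.1 (abs_walkWeight_sub_walkWeight_le w w' p)).2
  linarith

theorem Neighboring.symm {V : Type*} [Fintype V] {G : SimpleGraph V} {w w' : Sym2 V → ℝ}
    (h : Neighboring G w w') : Neighboring G w' w := by
  simpa only [Neighboring, abs_sub_comm] using h

theorem Neighboring.abs_wdistSym2_sub_le {V : Type*} [Fintype V] {G : SimpleGraph V}
    (hG : G.Connected) {w w' : Sym2 V → ℝ} (h : Neighboring G w w') (e : Sym2 V) :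
    |wdistSym2 G w e - wdistSym2 G w' e| ≤ 1 := by
  induction e with
  | _ u v =>
    change |wdist G w u v - wdist G w' u v| ≤ 1
    have h1 := wdist_le_wdist_add hG w w' u v
    have h2 := wdist_le_wdist_add hG w' w u v
    have h3 : _ ≤ _ := h
    have h4 : _ ≤ _ := h.symm
    rw [abs_le]
    constructor <;> linarith

open Classical in
theorem card_filter_mem_edgeSet_shortcutGraph_le {V : Type*} [Fintype V] (V₁ : Finset V) :
    (Finset.univ.filter fun e => e ∈ (shortcutGraph V₁).edgeSet).card ≤ V₁.card.choose 2 := by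
  rw [← Sym2.card_image_offDiag]
  refine Finset.card_le_card fun e he => ?_
  induction e with
  | _ u v =>
    have he' : (shortcutGraph V₁).Adj u v := (Finset.mem_filter.1 he).2
    exact Finset.mem_image.2 ⟨(u, v), Finset.mem_offDiag.2 he', rfl⟩

theorem le_sqrt_add_one_of_eq_floor_or_ceil {n s : ℕ} (hs : s = ⌊√(n : ℝ)⌋₊ ∨ s = ⌈√(n : ℝ)⌉₊) :
    (s : ℝ) ≤ √n + 1 := by
  rcases hs with rfl | rfl
  · exact (Nat.floor_le (Real.sqrt_nonneg _)).trans (by linarith)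
  · exact (Nat.ceil_lt_add_one (Real.sqrt_nonneg _)).le

theorem choose_two_le_of_eq_floor_or_ceil {n s : ℕ}
    (hs : s = ⌊√(n : ℝ)⌋₊ ∨ s = ⌈√(n : ℝ)⌉₊) : s.choose 2 ≤ n := by
  have hle := le_sqrt_add_one_of_eq_floor_or_ceil hs
  rcases Nat.eq_zero_or_pos n with rfl | hn
  · simp at hs; simp [hs]
  have hn1 : (1 : ℝ) ≤ n := by exact_mod_cast hn
  have hr1 : 1 ≤ √(n : ℝ) := Real.one_le_sqrt.2 hn1
  have hsq : √(n : ℝ) * √n = n := Real.mul_self_sqrt (by linarith)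
  have : ((s.choose 2 : ℕ) : ℝ) ≤ n := by
    rw [Nat.cast_choose_two]
    rcases Nat.eq_zero_or_pos s with rfl | hs0
    · simp
    have : (1 : ℝ) ≤ s := by exact_mod_cast hs0
    -- With `r = √n ≥ 1` and `s ≤ r + 1`: `s (s - 1) / 2 ≤ (r + 1) r / 2 ≤ r ^ 2`.
    nlinarith
  exact_mod_cast this

/-! ### Privacy: calibration of the noise and averaging over the sample -/

variable {V : Type*}

open Classical in
/-- The noiseless weights of the synthetic graph. -/
noncomputable def noiselessWeight (G : SimpleGraph V) (w : Sym2 V → ℝ) (V₁ : Finset V) :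
    Sym2 V → ℝ := fun e =>
  if e ∈ (shortcutGraph V₁).edgeSet then wdistSym2 G w e else if e ∈ G.edgeSet then w e else 0

open Classical in
/-- The synthetic graph as a function of its noisy weights. -/
noncomputable def publish (G : SimpleGraph V) (V₁ : Finset V) (Y : Sym2 V → ℝ) :
    WeightedGraph V :=
  (G ⊔ shortcutGraph V₁, fun e =>
    if e ∈ (shortcutGraph V₁).edgeSet then Y e else if e ∈ G.edgeSet then Y e else 0)

/-- Isolates the dependence on `w` as a translation of the noise, so that privacy reduces to
comparing translated product measures. -/
theorem syntheticGraph_eq_publish (G : SimpleGraph V) (w : Sym2 V → ℝ) (V₁ : Finset V)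
    (X : Sym2 V → ℝ) :
    syntheticGraph G w V₁ X = publish G V₁ fun e => X e + noiselessWeight G w V₁ e := by
  simp only [syntheticGraph, publish, noiselessWeight, Prod.mk.injEq, true_and]
  funext e
  split_ifs <;> ring

theorem measurable_publish (G : SimpleGraph V) (V₁ : Finset V) : Measurable (publish G V₁) := by
  refine measurable_const.prodMk (measurable_pi_lambda _ fun e => ?_)
  split_ifs
  · exact measurable_pi_apply e
  · exact measurable_pi_apply e
  · exact measurable_const

theorem measurable_syntheticGraph (G : SimpleGraph V) (w : Sym2 V → ℝ) (V₁ : Finset V) :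
    Measurable (syntheticGraph G w V₁) := by
  have : syntheticGraph G w V₁ =
      publish G V₁ ∘ fun X e => X e + noiselessWeight G w V₁ e :=
    funext fun X => syntheticGraph_eq_publish G w V₁ X
  rw [this]
  exact (measurable_publish G V₁).comp
    (measurable_pi_lambda _ fun e => (measurable_pi_apply e).add_const _)

variable [Fintype V]

theorem edgeScale_pos {ε : ℝ} (hε : 0 < ε) : 0 < edgeScale ε := by
  unfold edgeScale; positivity

theorem log_two_le_log_one_div {δ : ℝ} (hδ : 0 < δ) (hδ' : δ ≤ 1 / 2) :
    Real.log 2 ≤ Real.log (1 / δ) := by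
  refine Real.log_le_log (by norm_num) ?_
  rw [le_div_iff₀ hδ]
  linarith

theorem shortcutScale_pos {n : ℕ} (hn : 0 < n) {ε δ : ℝ} (hε : 0 < ε) (hδ : 0 < δ)
    (hδ' : δ ≤ 1 / 2) : 0 < shortcutScale n ε δ := by
  have := (Real.log_pos one_lt_two).trans_le (log_two_le_log_one_div hδ hδ')
  have : (0 : ℝ) < n := by exact_mod_cast hn
  unfold shortcutScale
  positivity

theorem shortcutScale_sq (n : ℕ) {ε δ : ℝ} (hδ : 0 < δ) (hδ' : δ ≤ 1 / 2) :
    shortcutScale n ε δ ^ 2 = 8 * n * Real.log (1 / δ) / (ε / 2) ^ 2 := by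
  have := (Real.log_pos one_lt_two).trans_le (log_two_le_log_one_div hδ hδ')
  rw [shortcutScale, div_pow, mul_pow, mul_pow, mul_pow, Real.sq_sqrt (by norm_num),
    Real.sq_sqrt (by positivity), Real.sq_sqrt this.le]
  ring

theorem one_le_shortcutScale {n : ℕ} (hn : 0 < n) {ε δ : ℝ} (hε : 0 < ε) (hε' : ε < 2)
    (hδ : 0 < δ) (hδ' : δ ≤ 1 / 2) : 1 ≤ shortcutScale n ε δ := by
  have hlog := (Real.log_two_gt_d9).le.trans (log_two_le_log_one_div hδ hδ')
  have hn1 : (1 : ℝ) ≤ n := by exact_mod_cast hn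
  rw [← one_le_sq_iff₀ (shortcutScale_pos hn hε hδ hδ').le, shortcutScale_sq n hδ hδ',
    le_div_iff₀ (by positivity)]
  nlinarith

/-- The Chernoff exponent of the total privacy loss on `k ≤ n` shortcut edges. -/
theorem exp_privacyLoss_le {n k : ℕ} (hn : 0 < n) (hk : k ≤ n) {ε δ : ℝ} (hε : 0 < ε)
    (hε' : ε < 2) (hδ : 0 < δ) (hδ' : δ ≤ 1 / 2) :
    Real.exp (-(2 * Real.log (1 / δ) / (ε / 2)) * (ε / 2) +
      k * ((2 * Real.log (1 / δ) / (ε / 2) + (2 * Real.log (1 / δ) / (ε / 2)) ^ 2 / 2) *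
        (1 / shortcutScale n ε δ) ^ 2)) ≤ δ := by
  have hlog := (Real.log_two_gt_d9).le.trans (log_two_le_log_one_div hδ hδ')
  have hn0 : (0 : ℝ) < n := by exact_mod_cast hn
  have hk' : (k : ℝ) ≤ n := by exact_mod_cast hk
  rw [← Real.le_log_iff_exp_le hδ]
  have hlogδ : Real.log δ = -Real.log (1 / δ) := by rw [one_div, Real.log_inv, neg_neg]
  rw [hlogδ, div_pow 1, shortcutScale_sq n hδ hδ', one_pow]
  set Λ := Real.log (1 / δ)
  have hΛ : 0 < Λ := by linarith
  -- With `Λ = log (1 / δ)` the exponent is at most `-2Λ + ε / 8 + Λ / 4`. This is at most `-Λ`,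
  -- because `ε / 8 < 1 / 4` and `Λ ≥ log 2`.
  have hkey : (n : ℝ) * ((2 * Λ / (ε / 2) + (2 * Λ / (ε / 2)) ^ 2 / 2) *
      (1 / (8 * n * Λ / (ε / 2) ^ 2))) = ε / 8 + Λ / 4 := by
    field_simp
    ring
  have hmono : (k : ℝ) * ((2 * Λ / (ε / 2) + (2 * Λ / (ε / 2)) ^ 2 / 2) *
      (1 / (8 * n * Λ / (ε / 2) ^ 2))) ≤ n * ((2 * Λ / (ε / 2) + (2 * Λ / (ε / 2)) ^ 2 / 2) *
      (1 / (8 * n * Λ / (ε / 2) ^ 2))) := by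
    gcongr
  have hfirst : -(2 * Λ / (ε / 2)) * (ε / 2) = -2 * Λ := by field_simp
  rw [hkey] at hmono
  rw [hfirst]
  linarith

open Classical in
/-- The location parameters of the noise. -/
noncomputable def noiseMean (V₁ : Finset V) (ε δ γ : ℝ) : Sym2 V → ℝ := fun e =>
  if e ∈ (shortcutGraph V₁).edgeSet then
    shortcutScale (Fintype.card V) ε δ * Real.log (Fintype.card V / γ)
  else edgeScale ε * Real.log ((Fintype.card V : ℝ) ^ 2 / γ)

open Classical in
/-- The scale parameters of the noise. -/
noncomputable def noiseScale (V₁ : Finset V) (ε δ : ℝ) : Sym2 V → ℝ := fun e =>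
  if e ∈ (shortcutGraph V₁).edgeSet then shortcutScale (Fintype.card V) ε δ else edgeScale ε

open Classical in
theorem noiseLaw_eq_pi (V₁ : Finset V) (ε δ γ : ℝ) :
    noiseLaw V₁ ε δ γ = Measure.pi fun e =>
      laplaceMeasure (noiseMean V₁ ε δ γ e) (noiseScale V₁ ε δ e) := by
  refine congrArg Measure.pi (funext fun e => ?_)
  unfold noiseMean noiseScale
  split_ifs <;> rfl

theorem noiseScale_pos [Nonempty V] (V₁ : Finset V) {ε δ : ℝ} (hε : 0 < ε) (hδ : 0 < δ)
    (hδ' : δ ≤ 1 / 2) (e : Sym2 V) : 0 < noiseScale V₁ ε δ e := by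
  unfold noiseScale
  split_ifs
  · exact shortcutScale_pos Fintype.card_pos hε hδ hδ'
  · exact edgeScale_pos hε

open Classical in
theorem noiseLaw_map_syntheticGraph [Nonempty V] (G : SimpleGraph V) (w : Sym2 V → ℝ)
    (V₁ : Finset V) {ε δ : ℝ} (hε : 0 < ε) (hδ : 0 < δ) (hδ' : δ ≤ 1 / 2) (γ : ℝ) :
    (noiseLaw V₁ ε δ γ).map (syntheticGraph G w V₁) =
      (Measure.pi fun e => laplaceMeasure (noiseMean V₁ ε δ γ e + noiselessWeight G w V₁ e)
        (noiseScale V₁ ε δ e)).map (publish G V₁) := by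
  have hprob : ∀ m e, IsProbabilityMeasure (laplaceMeasure m (noiseScale V₁ ε δ e)) := fun m e =>
    isProbabilityMeasure_laplaceMeasure _ (noiseScale_pos V₁ hε hδ hδ' e)
  have hfun : syntheticGraph G w V₁ =
      publish G V₁ ∘ fun X e => X e + noiselessWeight G w V₁ e :=
    funext fun X => syntheticGraph_eq_publish G w V₁ X
  rw [hfun, ← Measure.map_map (measurable_publish G V₁)
    (measurable_pi_lambda _ fun e => (measurable_pi_apply e).add_const _), noiseLaw_eq_pi]
  simp_rw [← laplaceMeasure_map_add_const]
  have : ∀ e, SigmaFinite ((laplaceMeasure (noiseMean V₁ ε δ γ e) (noiseScale V₁ ε δ e)).map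
      (· + noiselessWeight G w V₁ e)) := fun e => by
    rw [laplaceMeasure_map_add_const]; infer_instance
  rw [← Measure.pi_map_pi (f := fun e x => x + noiselessWeight G w V₁ e)
    fun e => (measurable_add_const _).aemeasurable]

open Classical in
theorem noiseLaw_map_syntheticGraph_apply_le [Nonempty V] {G : SimpleGraph V} (hG : G.Connected)
    {w w' : Sym2 V → ℝ} (hw : Neighboring G w w') {V₁ : Finset V}
    (hV₁ : V₁.card.choose 2 ≤ Fintype.card V) {ε δ : ℝ} (hε : 0 < ε) (hε' : ε < 2) (hδ : 0 < δ)
    (hδ' : δ ≤ 1 / 2) (γ : ℝ) {S : Set (WeightedGraph V)} (hS : MeasurableSet S) :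
    (noiseLaw V₁ ε δ γ).map (syntheticGraph G w V₁) S ≤
      ENNReal.ofReal (Real.exp ε) * (noiseLaw V₁ ε δ γ).map (syntheticGraph G w' V₁) S +
        ENNReal.ofReal δ := by
  have hn : 0 < Fintype.card V := Fintype.card_pos
  rw [noiseLaw_map_syntheticGraph G w V₁ hε hδ hδ', noiseLaw_map_syntheticGraph G w' V₁ hε hδ hδ',
    Measure.map_apply (measurable_publish G V₁) hS, Measure.map_apply (measurable_publish G V₁) hS]
  set A : Finset (Sym2 V) := Finset.univ.filter fun e => e ∈ (shortcutGraph V₁).edgeSet with hAdef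
  -- The law for `w'` is the reference and is translated to the law for `w`; the budget `ε` is split
  -- evenly between original and shortcut edges.
  have hmain := pi_laplaceMeasure_add_apply_le
    (fun e => noiseMean V₁ ε δ γ e + noiselessWeight G w' V₁ e) (noiseScale V₁ ε δ)
    (fun e => noiselessWeight G w V₁ e - noiselessWeight G w' V₁ e)
    (noiseScale_pos V₁ hε hδ hδ') A (η := 1 / shortcutScale (Fintype.card V) ε δ) (ε₀ := ε / 2)
    (t := 2 * Real.log (1 / δ) / (ε / 2)) ?_ ?_ ?_ ?_ (ε / 2) (measurable_publish G V₁ hS)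
  · refine le_trans (le_of_eq ?_) (hmain.trans (add_le_add (le_of_eq ?_)
      (ENNReal.ofReal_le_ofReal ?_)))
    · simp only [add_assoc, add_sub_cancel]
    · rw [add_halves]
    · exact exp_privacyLoss_le hn
        ((card_filter_mem_edgeSet_shortcutGraph_le V₁).trans hV₁) hε hε' hδ hδ'
  · rw [div_le_one (shortcutScale_pos hn hε hδ hδ')]
    exact one_le_shortcutScale hn hε hε' hδ hδ'
  · intro e he
    have he' : e ∈ (shortcutGraph V₁).edgeSet := (Finset.mem_filter.1 he).2
    simp only [noiselessWeight, noiseScale, he', if_true]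
    have := (shortcutScale_pos hn hε hδ hδ').le
    gcongr
    exact hw.abs_wdistSym2_sub_le hG e
  · have hterm : ∀ e ∈ Aᶜ, |noiselessWeight G w V₁ e - noiselessWeight G w' V₁ e| /
        noiseScale V₁ ε δ e = if e ∈ G.edgeSet then |w e - w' e| * (ε / 2) else 0 := by
      intro e he
      have he' : e ∉ (shortcutGraph V₁).edgeSet := by simpa [hAdef] using he
      simp only [noiselessWeight, noiseScale, he', if_false, edgeScale]
      split_ifs
      · rw [div_div_eq_mul_div, div_one]
      · simp
    rw [Finset.sum_congr rfl hterm, ← Finset.sum_filter, ← Finset.sum_mul]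
    have hle : ∑ e ∈ Aᶜ with e ∈ G.edgeSet, |w e - w' e| ≤ 1 := by
      refine le_trans (Finset.sum_le_sum_of_subset_of_nonneg (fun e he => ?_)
        fun e _ _ => abs_nonneg _) hw
      exact mem_edgeFinset.2 (Finset.mem_filter.1 he).2
    nlinarith
  · have := (Real.log_pos one_lt_two).trans_le (log_two_le_log_one_div hδ hδ')
    positivity

theorem isDP_privateAPSP {G : SimpleGraph V} (hG : G.Connected) {s : ℕ}
    (hs : s.choose 2 ≤ Fintype.card V) {ε δ : ℝ} (hε : 0 < ε) (hε' : ε < 2) (hδ : 0 < δ)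
    (hδ' : δ ≤ 1 / 2) (γ : ℝ) : IsDP G ε δ (privateAPSP G s ε δ γ) := by
  intro w w' hw S hS
  have := hG.nonempty
  simp only [privateAPSP, Measure.smul_apply, Measure.finsetSum_apply, smul_eq_mul]
  set F := (Finset.univ.powersetCard s : Finset (Finset V))
  calc _ ≤ (F.card : ℝ≥0∞)⁻¹ * ∑ V₁ ∈ F, (ENNReal.ofReal (Real.exp ε) *
        (noiseLaw V₁ ε δ γ).map (syntheticGraph G w' V₁) S + ENNReal.ofReal δ) := by
        gcongr with V₁ hV₁
        refine noiseLaw_map_syntheticGraph_apply_le hG hw ?_ hε hε' hδ hδ' γ hS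
        rwa [(Finset.mem_powersetCard.1 hV₁).2]
    _ = ENNReal.ofReal (Real.exp ε) * ((F.card : ℝ≥0∞)⁻¹ *
          ∑ V₁ ∈ F, (noiseLaw V₁ ε δ γ).map (syntheticGraph G w' V₁) S) +
        (F.card : ℝ≥0∞)⁻¹ * F.card * ENNReal.ofReal δ := by
        rw [Finset.sum_add_distrib, ← Finset.mul_sum, Finset.sum_const, nsmul_eq_mul]
        ring
    _ ≤ _ := by
        gcongr
        -- Only `≤ 1` is available: `F` may be empty under the present assumption on `s`.
        exact mul_le_of_le_one_left' (ENNReal.inv_mul_le_one _)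

end SimpleGraph

/-! ### Walks and distances for nonnegative weights -/

namespace SimpleGraph

section Walks

variable {V : Type*} {G : SimpleGraph V} {w : Sym2 V → ℝ}

theorem walkWeight_nil (u : V) : walkWeight w (Walk.nil : G.Walk u u) = 0 := by
  simp [walkWeight]

theorem walkWeight_cons {u v x : V} (h : G.Adj u v) (p : G.Walk v x) :
    walkWeight w (Walk.cons h p) = w s(u, v) + walkWeight w p := by
  simp [walkWeight]

theorem walkWeight_append {u v x : V} (p : G.Walk u v) (q : G.Walk v x) :
    walkWeight w (p.append q) = walkWeight w p + walkWeight w q := by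
  simp [walkWeight]

theorem walkWeight_reverse {u v : V} (p : G.Walk u v) :
    walkWeight w p.reverse = walkWeight w p := by
  simp [walkWeight, List.sum_reverse]

theorem walkWeight_nonneg (hw : ∀ e ∈ G.edgeSet, 0 ≤ w e) {u v : V} (p : G.Walk u v) :
    0 ≤ walkWeight w p := by
  refine List.sum_nonneg fun x hx => ?_
  obtain ⟨e, he, rfl⟩ := List.mem_map.1 hx
  exact hw e (p.edges_subset_edgeSet he)

/-- Bypassing deletes closed pieces, whose weight is nonnegative. Hence all walks, not only paths,
bound `wdist` from above, which yields the triangle inequality. -/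
theorem walkWeight_bypass_le [DecidableEq V] (hw : ∀ e ∈ G.edgeSet, 0 ≤ w e) {u v : V}
    (p : G.Walk u v) : walkWeight w p.bypass ≤ walkWeight w p := by
  induction p with
  | nil => exact le_rfl
  | cons h p ih =>
    rw [walkWeight_cons, Walk.bypass]
    have hwe := hw _ ((mem_edgeSet G).2 h)
    split_ifs with hs
    · have hsplit := congrArg (walkWeight w) (p.bypass.take_spec hs)
      rw [walkWeight_append] at hsplit
      have := walkWeight_nonneg hw (p.bypass.takeUntil _ hs)
      linarith
    · rw [walkWeight_cons]
      linarith

variable [Finite V]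

theorem wdist_le_walkWeight (hw : ∀ e ∈ G.edgeSet, 0 ≤ w e) {u v : V} (p : G.Walk u v) :
    wdist G w u v ≤ walkWeight w p := by
  classical
  exact (wdist_le_walkWeight_path G w p.toPath).trans (walkWeight_bypass_le hw p)

theorem wdist_triangle (hG : G.Connected) (hw : ∀ e ∈ G.edgeSet, 0 ≤ w e) (u v x : V) :
    wdist G w u x ≤ wdist G w u v + wdist G w v x := by
  obtain ⟨p, hp⟩ := exists_path_walkWeight_eq_wdist hG w u v
  obtain ⟨q, hq⟩ := exists_path_walkWeight_eq_wdist hG w v x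
  rw [← hp, ← hq, ← walkWeight_append]
  exact wdist_le_walkWeight hw _

theorem wdist_nonneg (hG : G.Connected) (hw : ∀ e ∈ G.edgeSet, 0 ≤ w e) (u v : V) :
    0 ≤ wdist G w u v := by
  obtain ⟨p, hp⟩ := exists_path_walkWeight_eq_wdist hG w u v
  exact hp ▸ walkWeight_nonneg hw p.1

theorem wdist_le_of_adj (hw : ∀ e ∈ G.edgeSet, 0 ≤ w e) {u v : V} (h : G.Adj u v) :
    wdist G w u v ≤ w s(u, v) := by
  simpa [walkWeight] using wdist_le_walkWeight hw h.toWalk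

end Walks

/-! ### Cutting a walk at its first sampled vertex -/

section Splitting

variable {V : Type*} {G : SimpleGraph V} {V₁ : Finset V}

theorem notMem_edgeSet_shortcutGraph_of_left {u v : V} (hu : u ∉ V₁) :
    s(u, v) ∉ (shortcutGraph V₁).edgeSet := fun h => hu h.1

/-- Here `x` is the first vertex of the walk in `V₁`. Every edge of `q` starts outside `V₁`, so it
is no shortcut; `q.support.take q.length` is the support without its last vertex `x`. -/
theorem exists_append_of_mem_support {u v : V} (p : G.Walk u v) (h : ∃ y ∈ p.support, y ∈ V₁) :
    ∃ x ∈ V₁, ∃ (q : G.Walk u x) (r : G.Walk x v), p = q.append r ∧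
      (∀ e ∈ q.edges, e ∉ (shortcutGraph V₁).edgeSet) ∧
      ∀ y ∈ q.support.take q.length, y ∉ V₁ := by
  induction p with
  | @nil u =>
    obtain ⟨y, hy, hyV⟩ := h
    obtain rfl : y = u := by simpa using hy
    exact ⟨y, hyV, Walk.nil, Walk.nil, rfl, by simp, by simp⟩
  | @cons u a v hadj p ih =>
    by_cases hu : u ∈ V₁
    · exact ⟨u, hu, Walk.nil, Walk.cons hadj p, rfl, by simp, by simp⟩
    · obtain ⟨y, hy, hyV⟩ := h
      rw [Walk.support_cons, List.mem_cons] at hy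
      obtain ⟨x, hx, q, r, rfl, hq, hq'⟩ :=
        ih ⟨y, hy.resolve_left fun h => hu (h ▸ hyV), hyV⟩
      refine ⟨x, hx, Walk.cons hadj q, r, rfl, ?_, ?_⟩
      · intro e he
        rw [Walk.edges_cons, List.mem_cons] at he
        rcases he with rfl | he
        · exact notMem_edgeSet_shortcutGraph_of_left hu
        · exact hq e he
      · intro z hz
        rw [Walk.support_cons, Walk.length_cons, List.take_succ_cons, List.mem_cons] at hz
        rcases hz with rfl | hz
        · exact hu
        · exact hq' z hz

theorem notMem_edgeSet_shortcutGraph_of_support {u v : V} (p : G.Walk u v)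
    (h : ∀ y ∈ p.support, y ∉ V₁) : ∀ e ∈ p.edges, e ∉ (shortcutGraph V₁).edgeSet := by
  intro e he
  induction e with
  | _ a b => exact notMem_edgeSet_shortcutGraph_of_left (h a (p.fst_mem_support_of_mem_edges he))

/-- The first `L` vertices of the walk, if there are as many, meet `V₁`. -/
def HitsPrefix (V₁ : Finset V) (L : ℕ) {u v : V} (p : G.Walk u v) : Prop :=
  L ≤ p.support.length → ∃ y ∈ p.support.take L, y ∈ V₁

/-- If `q` were longer than `L`, the first `L` vertices of the whole walk would lie on `q` before
its end and miss `V₁`. -/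
theorem HitsPrefix.length_le {L : ℕ} {u v x : V} {q : G.Walk u x} {r : G.Walk x v}
    (h : HitsPrefix V₁ L (q.append r)) (hq : ∀ y ∈ q.support.take q.length, y ∉ V₁) :
    q.length ≤ L := by
  by_contra! hlt
  have hlen : q.support.length = q.length + 1 := q.length_support
  have hsupp : (q.append r).support.take L = q.support.take L := by
    rw [Walk.support_append, List.take_append_of_le_length (by omega)]
  obtain ⟨y, hy, hyV⟩ := h (by rw [Walk.support_append, List.length_append]; omega)
  rw [hsupp] at hy
  exact hq y ((List.take_prefix_take_left hlt.le).subset hy) hyV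

end Splitting

/-! ### Deterministic error bound -/

section Error

variable {V : Type*} {G : SimpleGraph V} {w X : Sym2 V → ℝ} {V₁ : Finset V} {M₀ M₁ : ℝ}

theorem syntheticGraph_snd_of_mem_shortcut {e : Sym2 V} (he : e ∈ (shortcutGraph V₁).edgeSet) :
    (syntheticGraph G w V₁ X).2 e = wdistSym2 G w e + X e := by
  simp [syntheticGraph, he]

theorem syntheticGraph_snd_of_mem {e : Sym2 V} (he : e ∉ (shortcutGraph V₁).edgeSet)
    (heG : e ∈ G.edgeSet) : (syntheticGraph G w V₁ X).2 e = w e + X e := by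
  simp [syntheticGraph, he, heG]

theorem connected_syntheticGraph (hG : G.Connected) :
    (syntheticGraph G w V₁ X).1.Connected :=
  hG.mono le_sup_left

variable [Finite V]

theorem wdist_le_syntheticGraph_snd (hw : ∀ e ∈ G.edgeSet, 0 ≤ w e) (hX : ∀ e, 0 ≤ X e)
    {u v : V} (h : (syntheticGraph G w V₁ X).1.Adj u v) :
    wdist G w u v ≤ (syntheticGraph G w V₁ X).2 s(u, v) := by
  by_cases he : s(u, v) ∈ (shortcutGraph V₁).edgeSet
  · rw [syntheticGraph_snd_of_mem_shortcut he]
    change wdist G w u v ≤ wdist G w u v + _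
    linarith [hX s(u, v)]
  · have hadj : G.Adj u v := h.resolve_right he
    rw [syntheticGraph_snd_of_mem he hadj]
    linarith [hX s(u, v), wdist_le_of_adj hw hadj]

theorem syntheticGraph_snd_nonneg (hG : G.Connected) (hw : ∀ e ∈ G.edgeSet, 0 ≤ w e)
    (hX : ∀ e, 0 ≤ X e) : ∀ e ∈ (syntheticGraph G w V₁ X).1.edgeSet,
      0 ≤ (syntheticGraph G w V₁ X).2 e := by
  intro e he
  induction e with
  | _ u v => exact (wdist_nonneg hG hw u v).trans (wdist_le_syntheticGraph_snd hw hX he)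

/-- Each edge of the synthetic graph weighs at least the true distance of its ends; the triangle
inequality in `G` extends this to walks. -/
theorem wdist_le_wdist_syntheticGraph (hG : G.Connected) (hw : ∀ e ∈ G.edgeSet, 0 ≤ w e)
    (hX : ∀ e, 0 ≤ X e) (u v : V) :
    wdist G w u v ≤
      wdist (syntheticGraph G w V₁ X).1 (syntheticGraph G w V₁ X).2 u v := by
  have hle : ∀ {a b : V} (p : (syntheticGraph G w V₁ X).1.Walk a b),
      wdist G w a b ≤ walkWeight (syntheticGraph G w V₁ X).2 p := by
    intro a b p
    induction p with
    | nil => rw [wdist_self, walkWeight_nil]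
    | @cons a c b h p ih =>
      rw [walkWeight_cons]
      linarith [wdist_triangle hG hw a c b, wdist_le_syntheticGraph_snd hw hX h]
  obtain ⟨p, hp⟩ := exists_path_walkWeight_eq_wdist (connected_syntheticGraph hG)
    (syntheticGraph G w V₁ X).2 u v
  exact hp ▸ hle p.1

theorem wdist_syntheticGraph_le_of_notMem (hG : G.Connected) (hw : ∀ e ∈ G.edgeSet, 0 ≤ w e)
    (hX : ∀ e, 0 ≤ X e) (hX₀ : ∀ e ∉ (shortcutGraph V₁).edgeSet, X e ≤ M₀) {u v : V}
    (p : G.Walk u v) (hp : ∀ e ∈ p.edges, e ∉ (shortcutGraph V₁).edgeSet) :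
    wdist (syntheticGraph G w V₁ X).1 (syntheticGraph G w V₁ X).2 u v ≤
      walkWeight w p + p.length * M₀ := by
  induction p with
  | nil => simp [wdist_self, walkWeight_nil]
  | @cons u a v h p ih =>
    simp only [Walk.edges_cons, List.mem_cons, forall_eq_or_imp] at hp
    have hstep : wdist (syntheticGraph G w V₁ X).1 (syntheticGraph G w V₁ X).2 u a ≤
        w s(u, a) + M₀ := by
      refine (wdist_le_of_adj (syntheticGraph_snd_nonneg hG hw hX) (Or.inl h)).trans ?_
      rw [syntheticGraph_snd_of_mem hp.1 h]
      linarith [hX₀ _ hp.1]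
    have htri := wdist_triangle (connected_syntheticGraph hG)
      (syntheticGraph_snd_nonneg (V₁ := V₁) hG hw hX) u a v
    rw [walkWeight_cons, Walk.length_cons]
    push_cast
    linarith [ih hp.2]

theorem wdist_syntheticGraph_le_of_mem (hG : G.Connected) (hw : ∀ e ∈ G.edgeSet, 0 ≤ w e)
    (hX : ∀ e, 0 ≤ X e) (hX₁ : ∀ e ∈ (shortcutGraph V₁).edgeSet, X e ≤ M₁) (hM₁ : 0 ≤ M₁)
    {x y : V} (hx : x ∈ V₁) (hy : y ∈ V₁) :
    wdist (syntheticGraph G w V₁ X).1 (syntheticGraph G w V₁ X).2 x y ≤ wdist G w x y + M₁ := by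
  rcases eq_or_ne x y with rfl | hne
  · simpa [wdist_self] using hM₁
  · have hadj : (shortcutGraph V₁).Adj x y := ⟨hx, hy, hne⟩
    refine (wdist_le_of_adj (syntheticGraph_snd_nonneg hG hw hX) (Or.inr hadj)).trans ?_
    rw [syntheticGraph_snd_of_mem_shortcut hadj]
    change wdist G w x y + _ ≤ _
    linarith [hX₁ s(x, y) hadj]

/-- The error of the synthetic graph, if the noise is nonnegative and bounded and `V₁` meets both
ends of a shortest path. -/
theorem abs_wdist_syntheticGraph_sub_wdist_le (hG : G.Connected)
    (hw : ∀ e ∈ G.edgeSet, 0 ≤ w e) (hX : ∀ e, 0 ≤ X e)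
    (hX₀ : ∀ e ∉ (shortcutGraph V₁).edgeSet, X e ≤ M₀)
    (hX₁ : ∀ e ∈ (shortcutGraph V₁).edgeSet, X e ≤ M₁) (hM₀ : 0 ≤ M₀) (hM₁ : 0 ≤ M₁) {L : ℕ}
    {u v : V} (p : G.Walk u v) (hp : walkWeight w p = wdist G w u v) (hhit : HitsPrefix V₁ L p)
    (hhit' : HitsPrefix V₁ L p.reverse) :
    |wdist (syntheticGraph G w V₁ X).1 (syntheticGraph G w V₁ X).2 u v - wdist G w u v| ≤
      2 * L * M₀ + M₁ := by
  have hlow := wdist_le_wdist_syntheticGraph (V₁ := V₁) hG hw hX u v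
  have hLM : 0 ≤ L * M₀ := by positivity
  rw [abs_of_nonneg (by linarith), sub_le_iff_le_add']
  by_cases hex : ∃ y ∈ p.support, y ∈ V₁
  · obtain ⟨x, hx, q, r, rfl, hq, hq'⟩ := exists_append_of_mem_support p hex
    obtain ⟨y, hy, q₂, r₂, hr, hq₂, hq₂'⟩ :=
      exists_append_of_mem_support r.reverse ⟨x, by simp, hx⟩
    have hlen := hhit.length_le hq'
    rw [Walk.reverse_append, hr, ← Walk.append_assoc] at hhit'
    have hlen₂ := hhit'.length_le hq₂'
    have hweight : walkWeight w r = walkWeight w q₂ + walkWeight w r₂ := by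
      rw [← walkWeight_reverse, hr, walkWeight_append]
    rw [walkWeight_append] at hp
    have h1 := wdist_syntheticGraph_le_of_notMem hG hw hX hX₀ q hq
    have h2 := wdist_syntheticGraph_le_of_notMem hG hw hX hX₀ q₂ hq₂
    have h3 := wdist_syntheticGraph_le_of_mem hG hw hX hX₁ hM₁ hx hy
    have h4 : wdist G w x y ≤ walkWeight w r₂ := by
      rw [wdist_comm]; exact wdist_le_walkWeight hw r₂
    have hconn := connected_syntheticGraph (w := w) (V₁ := V₁) (X := X) hG
    have hnn := syntheticGraph_snd_nonneg (V₁ := V₁) hG hw hX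
    have t1 := wdist_triangle hconn hnn u x v
    have t2 := wdist_triangle hconn hnn x y v
    rw [wdist_comm _ _ y v] at t2
    have b1 : (q.length : ℝ) * M₀ ≤ L * M₀ := by gcongr
    have b2 : (q₂.length : ℝ) * M₀ ≤ L * M₀ := by gcongr
    linarith
  -- If `p` avoids `V₁`, it has at most `L` edges, for otherwise its prefix of `L` vertices would
  -- meet `V₁`; `p` itself is then cheap enough.
  · push Not at hex
    have hlen : p.length ≤ L := by
      by_contra! hlt
      obtain ⟨y, hy, hyV⟩ := hhit (by rw [Walk.length_support]; omega)
      exact hex y (List.mem_of_mem_take hy) hyV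
    have h1 := wdist_syntheticGraph_le_of_notMem hG hw hX hX₀ p
      (notMem_edgeSet_shortcutGraph_of_support p hex)
    have b1 : (p.length : ℝ) * M₀ ≤ L * M₀ := by gcongr
    linarith

end Error

end SimpleGraph

/-! ### Random samples meet long prefixes -/

theorem Nat.descFactorial_sub_le_pow_mul {n L : ℕ} (hL : L ≤ n) (s : ℕ) :
    ((n - L).descFactorial s : ℝ) ≤ (1 - L / n) ^ s * n.descFactorial s := by
  have hL' : (L : ℝ) ≤ n := by exact_mod_cast hL
  have h0 : (0 : ℝ) ≤ 1 - L / n := sub_nonneg.2 (div_le_one_of_le₀ hL' (Nat.cast_nonneg n))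
  induction s with
  | zero => simp
  | succ k ih =>
    rw [Nat.descFactorial_succ, Nat.descFactorial_succ, pow_succ]
    push_cast
    -- Factor by factor, `n - L - k ≤ (1 - L / n) (n - k)`; when `k ≥ n - L` the truncated left side
    -- is `0`.
    have hstep : ((n - L - k : ℕ) : ℝ) ≤ (1 - L / n) * (n - k : ℕ) := by
      rcases le_or_gt (n - L) k with hk | hk
      · rw [Nat.sub_eq_zero_of_le hk]
        simpa using mul_nonneg h0 (Nat.cast_nonneg (n - k))
      · rw [Nat.cast_sub hk.le, Nat.cast_sub hL, Nat.cast_sub (by omega)]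
        have hn : (0 : ℝ) < n := by exact_mod_cast (by omega : 0 < n)
        have hk' : 0 ≤ (L : ℝ) * k / n := by positivity
        have : (1 - (L : ℝ) / n) * (n - k) = n - L - k + L * k / n := by
          field_simp
          ring
        linarith
    calc _ ≤ ((1 - (L : ℝ) / n) * (n - k : ℕ)) * ((1 - L / n) ^ k * n.descFactorial k) := by
          gcongr
      _ = _ := by ring

/-- Divided by `n.choose s`, this bounds the probability that a random `s`-set misses `L` given
points. -/
theorem Nat.choose_sub_le_exp_mul_choose {n L : ℕ} (hL : L ≤ n) (s : ℕ) :
    ((n - L).choose s : ℝ) ≤ Real.exp (-(s * L / n)) * n.choose s := by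
  have hL' : (L : ℝ) ≤ n := by exact_mod_cast hL
  have h0 : (0 : ℝ) ≤ 1 - L / n := sub_nonneg.2 (div_le_one_of_le₀ hL' (Nat.cast_nonneg n))
  have h := Nat.descFactorial_sub_le_pow_mul hL s
  rw [Nat.descFactorial_eq_factorial_mul_choose, Nat.descFactorial_eq_factorial_mul_choose] at h
  push_cast at h
  have hf : (0 : ℝ) < s.factorial := by exact_mod_cast s.factorial_pos
  have h' : ((n - L).choose s : ℝ) ≤ (1 - L / n) ^ s * n.choose s := by
    refine le_of_mul_le_mul_left (h.trans_eq ?_) hf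
    ring
  refine h'.trans ?_
  gcongr
  calc (1 - (L : ℝ) / n) ^ s ≤ Real.exp (-(L / n)) ^ s := by
        gcongr
        exact Real.one_sub_le_exp_neg _
    _ = _ := by rw [← Real.exp_nat_mul]; congr 1; ring

open Classical in
/-- Most sets of `s` points meet every member of a small family of sets of `L` points. -/
theorem card_filter_exists_disjoint_le {V ι : Type*} [Fintype V] [Fintype ι] (A : ι → Finset V)
    (s L : ℕ) :
    (((Finset.univ.powersetCard s : Finset (Finset V)).filter fun V₁ =>
        ∃ i, (A i).card = L ∧ Disjoint V₁ (A i)).card : ℝ) ≤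
      Fintype.card ι * (Real.exp (-(s * L / Fintype.card V)) * (Fintype.card V).choose s) := by
  have hsub : ((Finset.univ.powersetCard s : Finset (Finset V)).filter fun V₁ =>
      ∃ i, (A i).card = L ∧ Disjoint V₁ (A i)) ⊆
      Finset.univ.biUnion fun i => if (A i).card = L then (A i)ᶜ.powersetCard s else ∅ := by
    intro V₁ hV₁
    obtain ⟨hV, i, hi, hdisj⟩ := Finset.mem_filter.1 hV₁
    refine Finset.mem_biUnion.2 ⟨i, Finset.mem_univ i, ?_⟩
    rw [if_pos hi, Finset.mem_powersetCard]
    exact ⟨Finset.subset_compl_iff_disjoint_right.2 hdisj, (Finset.mem_powersetCard.1 hV).2⟩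
  calc _ ≤ ((∑ i, (if (A i).card = L then (A i)ᶜ.powersetCard s else ∅).card : ℕ) : ℝ) := by
        exact_mod_cast (Finset.card_le_card hsub).trans Finset.card_biUnion_le
    _ = ∑ i, ((if (A i).card = L then (A i)ᶜ.powersetCard s else ∅).card : ℝ) := by push_cast; rfl
    _ ≤ ∑ _i : ι, (Real.exp (-(s * L / Fintype.card V)) * (Fintype.card V).choose s) := by
        refine Finset.sum_le_sum fun i _ => ?_
        split_ifs with hi
        · rw [Finset.card_powersetCard, Finset.card_compl, hi]
          exact Nat.choose_sub_le_exp_mul_choose (hi ▸ Finset.card_le_univ _) s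
        · rw [Finset.card_empty, Nat.cast_zero]
          positivity
    _ = _ := by rw [Finset.sum_const, nsmul_eq_mul, Finset.card_univ]

theorem half_sqrt_le_of_eq_floor_or_ceil {n s : ℕ} (hn : 0 < n)
    (hs : s = ⌊√(n : ℝ)⌋₊ ∨ s = ⌈√(n : ℝ)⌉₊) : √(n : ℝ) / 2 ≤ s := by
  have hr : 1 ≤ √(n : ℝ) := Real.one_le_sqrt.2 (by exact_mod_cast hn)
  rcases hs with rfl | rfl
  · have h1 := Nat.lt_floor_add_one (√(n : ℝ))
    have h2 : (1 : ℝ) ≤ ⌊√(n : ℝ)⌋₊ := by exact_mod_cast Nat.one_le_floor_iff _ |>.2 hr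
    linarith
  · have := Nat.le_ceil (√(n : ℝ))
    linarith

theorem le_card_of_eq_floor_or_ceil {n s : ℕ}
    (hs : s = ⌊√(n : ℝ)⌋₊ ∨ s = ⌈√(n : ℝ)⌉₊) : s ≤ n := by
  have hr : √(n : ℝ) ≤ n := by
    rw [Real.sqrt_le_left (Nat.cast_nonneg n)]
    rcases Nat.eq_zero_or_pos n with rfl | hn
    · simp
    · have : (1 : ℝ) ≤ n := by exact_mod_cast hn
      nlinarith
  rcases hs with rfl | rfl
  · exact Nat.floor_le_of_le hr
  · exact Nat.ceil_le.2 hr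

namespace SimpleGraph

variable {V : Type*}

/-- Length of the prefixes that the sample meets with high probability. -/
noncomputable def prefixLength (n : ℕ) (γ : ℝ) : ℕ := ⌈2 * √(n : ℝ) * Real.log ((n : ℝ) ^ 2 / γ)⌉₊

open Classical in
/-- The first `L` vertices of a walk (of its reverse, if `b`). -/
noncomputable def prefixFinset {G : SimpleGraph V} {u v : V} (p : G.Walk u v) (L : ℕ) (b : Bool) :
    Finset V :=
  ((if b then p.reverse.support else p.support).take L).toFinset

theorem hitsPrefix_of_not_disjoint {G : SimpleGraph V} {u v : V} (p : G.Path u v) {L : ℕ}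
    {V₁ : Finset V} (h : ∀ b, (prefixFinset p.1 L b).card = L →
      ¬Disjoint V₁ (prefixFinset p.1 L b)) :
    HitsPrefix V₁ L p.1 ∧ HitsPrefix V₁ L p.1.reverse := by
  classical
  have key : ∀ l : List V, l.Nodup → ((l.take L).toFinset.card = L →
      ¬Disjoint V₁ (l.take L).toFinset) → L ≤ l.length → ∃ y ∈ l.take L, y ∈ V₁ := by
    intro l hl h hL
    -- The vertices of a path are distinct, so a prefix of `L` entries has exactly `L` elements.
    have hcard : (l.take L).toFinset.card = L := by
      rw [List.toFinset_card_of_nodup (hl.sublist (List.take_sublist L l)), List.length_take,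
        min_eq_left hL]
    obtain ⟨y, hy, hy'⟩ := Finset.not_disjoint_iff.1 (h hcard)
    exact ⟨y, List.mem_toFinset.1 hy', hy⟩
  refine ⟨key _ p.2.support_nodup ?_, key _ p.2.reverse.support_nodup ?_⟩
  · simpa [prefixFinset] using h false
  · simpa only [prefixFinset, if_true] using h true

variable [Fintype V]

open Classical in
theorem card_filter_not_hitsPrefix_le [Nonempty V] {G : SimpleGraph V} (p : ∀ u v, G.Path u v)
    {s : ℕ} (hs : s = ⌊√(Fintype.card V : ℝ)⌋₊ ∨ s = ⌈√(Fintype.card V : ℝ)⌉₊) {γ : ℝ}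
    (hγ : 0 < γ) :
    (((Finset.univ.powersetCard s : Finset (Finset V)).filter fun V₁ =>
        ¬∀ u v, HitsPrefix V₁ (prefixLength (Fintype.card V) γ) (p u v).1 ∧
          HitsPrefix V₁ (prefixLength (Fintype.card V) γ) (p u v).1.reverse).card : ℝ) ≤
      2 * γ * (Finset.univ.powersetCard s : Finset (Finset V)).card := by
  set n := Fintype.card V with hn
  set L := prefixLength n γ with hL
  have hn0 : 0 < n := Fintype.card_pos
  have hn0' : (0 : ℝ) < n := by exact_mod_cast hn0
  have hexp : Real.exp (-(s * L / n)) ≤ γ / n ^ 2 := by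
    have hlow : Real.log ((n : ℝ) ^ 2 / γ) ≤ s * L / n := by
      -- There is no upper bound on `γ` here, so the logarithm may be nonpositive.
      rcases le_or_gt (Real.log ((n : ℝ) ^ 2 / γ)) 0 with h0 | h0
      · exact h0.trans (by positivity)
      rw [le_div_iff₀ hn0']
      -- The bounds `s ≥ √n / 2` and `L ≥ 2 √n log (n² / γ)` multiply to exactly what is needed;
      -- this explains the factor 2 in `prefixLength`.
      calc Real.log ((n : ℝ) ^ 2 / γ) * n
          = √(n : ℝ) / 2 * (2 * √(n : ℝ) * Real.log ((n : ℝ) ^ 2 / γ)) := by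
            have := Real.mul_self_sqrt hn0'.le
            linear_combination (-Real.log ((n : ℝ) ^ 2 / γ)) * this
        _ ≤ s * L := by
            gcongr
            · exact half_sqrt_le_of_eq_floor_or_ceil hn0 hs
            · exact Nat.le_ceil _
    calc Real.exp (-(s * L / n)) ≤ Real.exp (-Real.log ((n : ℝ) ^ 2 / γ)) := by gcongr
      _ = γ / n ^ 2 := by rw [← Real.log_inv, Real.exp_log (by positivity), inv_div]
  have hmain := card_filter_exists_disjoint_le
    (fun i : V × V × Bool => prefixFinset (p i.1 i.2.1).1 L i.2.2) s L
  have hsub : ((Finset.univ.powersetCard s : Finset (Finset V)).filter fun V₁ =>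
      ¬∀ u v, HitsPrefix V₁ L (p u v).1 ∧ HitsPrefix V₁ L (p u v).1.reverse) ⊆
      (Finset.univ.powersetCard s : Finset (Finset V)).filter fun V₁ =>
        ∃ i : V × V × Bool, (prefixFinset (p i.1 i.2.1).1 L i.2.2).card = L ∧
          Disjoint V₁ (prefixFinset (p i.1 i.2.1).1 L i.2.2) := by
    intro V₁ hV₁
    rw [Finset.mem_filter] at hV₁ ⊢
    refine ⟨hV₁.1, ?_⟩
    by_contra hcon
    push Not at hcon
    exact hV₁.2 fun u v => hitsPrefix_of_not_disjoint _ fun b => hcon (u, v, b)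
  calc _ ≤ _ := Nat.cast_le.2 (Finset.card_le_card hsub)
    _ ≤ _ := hmain
    _ ≤ (2 * n ^ 2) * (γ / n ^ 2 * n.choose s) := by
        -- Two prefixes, one from each end, for every ordered pair of vertices.
        have hcard : (Fintype.card (V × V × Bool) : ℝ) = 2 * n ^ 2 := by
          rw [Fintype.card_prod, Fintype.card_prod, Fintype.card_bool, ← hn]
          push_cast
          ring
        rw [hcard]
        gcongr
    _ = _ := by
        rw [Finset.card_powersetCard, Finset.card_univ, ← hn]
        field_simp

/-! ### Noise tails and the probability of an accurate output -/

theorem noiseMean_div_noiseScale [Nonempty V] (V₁ : Finset V) {ε δ : ℝ} (hε : 0 < ε)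
    (hδ : 0 < δ) (hδ' : δ ≤ 1 / 2) (γ : ℝ) (e : Sym2 V)
    [Decidable (e ∈ (shortcutGraph V₁).edgeSet)] :
    noiseMean V₁ ε δ γ e / noiseScale V₁ ε δ e =
      if e ∈ (shortcutGraph V₁).edgeSet then Real.log (Fintype.card V / γ)
      else Real.log ((Fintype.card V : ℝ) ^ 2 / γ) := by
  have h1 := shortcutScale_pos (Fintype.card_pos (α := V)) hε hδ hδ'
  have h0 := edgeScale_pos hε
  unfold noiseMean noiseScale
  split_ifs <;> field_simp

theorem noiseMean_nonneg [Nonempty V] (V₁ : Finset V) {ε δ γ : ℝ} (hε : 0 < ε)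
    (hδ : 0 < δ) (hδ' : δ ≤ 1 / 2) (hγ : 0 < γ) (hγ' : γ < 1) (e : Sym2 V) :
    0 ≤ noiseMean V₁ ε δ γ e := by
  have hn : (1 : ℝ) ≤ Fintype.card V := by exact_mod_cast Fintype.card_pos (α := V)
  have h1 := (shortcutScale_pos (Fintype.card_pos (α := V)) hε hδ hδ').le
  have h0 := (edgeScale_pos hε).le
  unfold noiseMean
  split_ifs
  · exact mul_nonneg h1 (Real.log_nonneg (by rw [le_div_iff₀ hγ]; linarith))
  · exact mul_nonneg h0 (Real.log_nonneg (by rw [le_div_iff₀ hγ]; nlinarith))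

/-- Union bound. A deviation beyond the mean has probability at most `exp (-μ / σ)`, which is `γ /
n` on at most `n` shortcut edges and `γ / n ^ 2` on at most `n ^ 2` other pairs: a total of `γ + γ`.
-/
theorem noiseLaw_exists_lt_abs_sub_le [Nonempty V] {V₁ : Finset V}
    (hV₁ : V₁.card.choose 2 ≤ Fintype.card V) {ε δ γ : ℝ} (hε : 0 < ε)
    (hδ : 0 < δ) (hδ' : δ ≤ 1 / 2) (hγ : 0 < γ) (hγ' : γ < 1) :
    noiseLaw V₁ ε δ γ {X | ∃ e, noiseMean V₁ ε δ γ e < |X e - noiseMean V₁ ε δ γ e|} ≤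
      ENNReal.ofReal (2 * γ) := by
  classical
  set n := Fintype.card V with hn
  have hn0 : (0 : ℝ) < n := by exact_mod_cast Fintype.card_pos (α := V)
  have hprob : ∀ e, IsProbabilityMeasure
      (laplaceMeasure (noiseMean V₁ ε δ γ e) (noiseScale V₁ ε δ e)) := fun e =>
    isProbabilityMeasure_laplaceMeasure _ (noiseScale_pos V₁ hε hδ hδ' e)
  have hset : {X : Sym2 V → ℝ | ∃ e, noiseMean V₁ ε δ γ e < |X e - noiseMean V₁ ε δ γ e|} =
      ⋃ e ∈ (Finset.univ : Finset (Sym2 V)), (fun X : Sym2 V → ℝ => X e) ⁻¹'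
        {x | noiseMean V₁ ε δ γ e < |x - noiseMean V₁ ε δ γ e|} := by
    ext X; simp
  rw [hset]
  refine (measure_biUnion_finset_le _ _).trans ?_
  have hcoord : ∀ e, noiseLaw V₁ ε δ γ ((fun X : Sym2 V → ℝ => X e) ⁻¹'
      {x | noiseMean V₁ ε δ γ e < |x - noiseMean V₁ ε δ γ e|}) ≤
      ENNReal.ofReal (if e ∈ (shortcutGraph V₁).edgeSet then γ / n else γ / n ^ 2) := by
    intro e
    rw [noiseLaw_eq_pi, (measurePreserving_eval _ e).measure_preimage
      (measurableSet_lt measurable_const (by fun_prop)).nullMeasurableSet]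
    refine (laplaceMeasure_lt_abs_sub_le _ (noiseScale_pos V₁ hε hδ hδ' e)
      (noiseMean_nonneg V₁ hε hδ hδ' hγ hγ' e)).trans (ENNReal.ofReal_le_ofReal ?_)
    rw [noiseMean_div_noiseScale V₁ hε hδ hδ']
    split_ifs <;> rw [← Real.log_inv, Real.exp_log (by positivity), inv_div]
  refine (Finset.sum_le_sum fun e _ => hcoord e).trans ?_
  rw [← ENNReal.ofReal_sum_of_nonneg fun e _ => by split_ifs <;> positivity]
  refine ENNReal.ofReal_le_ofReal ?_
  rw [Finset.sum_ite, Finset.sum_const, Finset.sum_const, nsmul_eq_mul, nsmul_eq_mul]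
  have hc1 : ((Finset.univ.filter fun e => e ∈ (shortcutGraph V₁).edgeSet).card : ℝ) ≤ n := by
    exact_mod_cast (card_filter_mem_edgeSet_shortcutGraph_le V₁).trans hV₁
  have hc0 : ((Finset.univ.filter fun e => e ∉ (shortcutGraph V₁).edgeSet).card : ℝ) ≤
      (n : ℝ) ^ 2 := by
    have h := (Finset.card_le_univ (Finset.univ.filter fun e =>
      e ∉ (shortcutGraph V₁).edgeSet)).trans
      (Fintype.card_le_of_surjective _ (Sym2.mk_surjective (α := V)))
    rw [Fintype.card_prod, ← sq] at h
    exact_mod_cast h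
  calc _ ≤ (n : ℝ) * (γ / n) + (n : ℝ) ^ 2 * (γ / n ^ 2) := by gcongr
    _ = 2 * γ := by field_simp; ring

/-- The final estimate of the error. -/
theorem error_le {n : ℕ} (hn : 2 ≤ n) {ε δ γ : ℝ} (hε : 0 < ε) (hδ : 0 < δ) (hδ' : δ ≤ 1 / 2)
    (hγ : 0 < γ) (hγ' : γ < 1) :
    2 * prefixLength n γ * (2 * (edgeScale ε * Real.log ((n : ℝ) ^ 2 / γ))) +
      2 * (shortcutScale n ε δ * Real.log (n / γ)) ≤
    300 * (ε⁻¹ * √(n : ℝ) * Real.log (n / γ) ^ 2 * √(Real.log (1 / δ))) := by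
  have hn2 : (2 : ℝ) ≤ n := by exact_mod_cast hn
  set ℓ := Real.log (n / γ) with hℓ
  set r := √(n : ℝ) with hr
  set Λ := √(Real.log (1 / δ)) with hΛ
  have hlog2 := Real.log_two_gt_d9
  have hℓ2 : 0.69 ≤ ℓ := by
    have : Real.log 2 ≤ ℓ := Real.log_le_log (by norm_num) (by rw [le_div_iff₀ hγ]; nlinarith)
    linarith
  have hr1 : 1 ≤ r := Real.one_le_sqrt.2 (by linarith)
  have hΛ1 : 0.8 ≤ Λ := by
    refine Real.le_sqrt_of_sq_le ?_
    exact le_trans (by norm_num) (hlog2.le.trans (log_two_le_log_one_div hδ hδ'))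
  have hlog : Real.log ((n : ℝ) ^ 2 / γ) ≤ 2 * ℓ := by
    have : 2 * ℓ = Real.log ((n / γ) ^ 2) := by rw [Real.log_pow, hℓ]; norm_num
    rw [this]
    refine Real.log_le_log (by positivity) ?_
    rw [div_pow]
    gcongr
    nlinarith
  have hlog0 : 0 ≤ Real.log ((n : ℝ) ^ 2 / γ) :=
    Real.log_nonneg (by rw [le_div_iff₀ hγ]; nlinarith)
  -- The `+ 1` from the ceiling is absorbed by `2 r ℓ`, since `r ℓ ≥ 0.69`.
  have hL : (prefixLength n γ : ℝ) ≤ 6 * (r * ℓ) := by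
    have h1 := (Nat.ceil_lt_add_one (a := 2 * r * Real.log ((n : ℝ) ^ 2 / γ)) (by positivity)).le
    have h2 : 2 * r * Real.log ((n : ℝ) ^ 2 / γ) ≤ 2 * r * (2 * ℓ) := by gcongr
    have h3 : 0.69 ≤ r * ℓ := by nlinarith
    change (⌈2 * r * Real.log ((n : ℝ) ^ 2 / γ)⌉₊ : ℝ) ≤ _
    linarith
  have hE : edgeScale ε = 2 * ε⁻¹ := by rw [edgeScale]; field_simp
  have hS : shortcutScale n ε δ ≤ 6 * (ε⁻¹ * r * Λ) := by
    have h2 : √2 ≤ 1.5 := by rw [Real.sqrt_le_left (by norm_num)]; norm_num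
    have : shortcutScale n ε δ = 4 * √2 * (ε⁻¹ * r * Λ) := by
      rw [shortcutScale]; field_simp; ring
    rw [this]
    gcongr
    linarith
  have hεi : 0 < ε⁻¹ := inv_pos.2 hε
  have hA : 2 * prefixLength n γ * (2 * (edgeScale ε * Real.log ((n : ℝ) ^ 2 / γ))) ≤
      2 * (6 * (r * ℓ)) * (2 * (2 * ε⁻¹ * (2 * ℓ))) := by
    rw [hE]
    gcongr
  have hB : 2 * (shortcutScale n ε δ * ℓ) ≤ 2 * (6 * (ε⁻¹ * r * Λ) * ℓ) := by gcongr
  -- `96 ≤ 120 · 0.8` inserts the missing factor `Λ`; below, `12 ≤ 180 · 0.69` inserts a second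
  -- factor `ℓ`.
  have hA' : 2 * (6 * (r * ℓ)) * (2 * (2 * ε⁻¹ * (2 * ℓ))) ≤ 120 * (ε⁻¹ * r * ℓ ^ 2 * Λ) := by
    have : 0 ≤ ε⁻¹ * r * ℓ ^ 2 := by positivity
    nlinarith
  have hB' : 2 * (6 * (ε⁻¹ * r * Λ) * ℓ) ≤ 180 * (ε⁻¹ * r * ℓ ^ 2 * Λ) := by
    have : 0 ≤ ε⁻¹ * r * Λ * ℓ := by positivity
    nlinarith
  linarith

/-- Outside of the two bad events, all distances of the synthetic graph are accurate. -/
theorem one_sub_le_noiseLaw_preimage [Nonempty V] {G : SimpleGraph V} (hG : G.Connected)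
    {w : Sym2 V → ℝ} (hw : ∀ e ∈ G.edgeSet, 0 ≤ w e) {V₁ : Finset V}
    (hV₁ : V₁.card.choose 2 ≤ Fintype.card V) {ε δ γ : ℝ} (hε : 0 < ε)
    (hδ : 0 < δ) (hδ' : δ ≤ 1 / 2) (hγ : 0 < γ) (hγ' : γ < 1) (p : ∀ u v, G.Path u v)
    (hp : ∀ u v, walkWeight w (p u v).1 = wdist G w u v)
    (hhit : ∀ u v, HitsPrefix V₁ (prefixLength (Fintype.card V) γ) (p u v).1 ∧
      HitsPrefix V₁ (prefixLength (Fintype.card V) γ) (p u v).1.reverse) :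
    1 - ENNReal.ofReal (2 * γ) ≤ noiseLaw V₁ ε δ γ (syntheticGraph G w V₁ ⁻¹'
      {H | ∀ u v : V, |wdist H.1 H.2 u v - wdist G w u v| ≤
        300 * (ε⁻¹ * √(Fintype.card V : ℝ) * Real.log (Fintype.card V / γ) ^ 2 *
          √(Real.log (1 / δ)))}) := by
  have hprob : IsProbabilityMeasure (noiseLaw V₁ ε δ γ) := by
    have : ∀ e, IsProbabilityMeasure
        (laplaceMeasure (noiseMean V₁ ε δ γ e) (noiseScale V₁ ε δ e)) := fun e =>
      isProbabilityMeasure_laplaceMeasure _ (noiseScale_pos V₁ hε hδ hδ' e)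
    rw [noiseLaw_eq_pi]
    infer_instance
  set bad := {X : Sym2 V → ℝ | ∃ e, noiseMean V₁ ε δ γ e < |X e - noiseMean V₁ ε δ γ e|}
  have hsub : badᶜ ⊆ syntheticGraph G w V₁ ⁻¹'
      {H | ∀ u v : V, |wdist H.1 H.2 u v - wdist G w u v| ≤
        300 * (ε⁻¹ * √(Fintype.card V : ℝ) * Real.log (Fintype.card V / γ) ^ 2 *
          √(Real.log (1 / δ)))} := by
    intro X hX u v
    -- Equal endpoints are treated apart because `error_le` needs `n ≥ 2`: for `n = 1` the factor
    -- `log (n / γ)` can be arbitrarily small.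
    rcases eq_or_ne u v with rfl | hne
    · rw [wdist_self, wdist_self, sub_zero, abs_zero]
      positivity
    have hn : 2 ≤ Fintype.card V := Fintype.one_lt_card_iff.2 ⟨u, v, hne⟩
    have hX' : ∀ e, |X e - noiseMean V₁ ε δ γ e| ≤ noiseMean V₁ ε δ γ e := by
      simpa [bad] using hX
    have h0 : ∀ e, 0 ≤ X e := fun e => by linarith [(abs_le.1 (hX' e)).1]
    have h1 : ∀ e, X e ≤ 2 * noiseMean V₁ ε δ γ e := fun e => by
      linarith [(abs_le.1 (hX' e)).2]
    have hn1 : (2 : ℝ) ≤ Fintype.card V := by exact_mod_cast hn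
    refine (abs_wdist_syntheticGraph_sub_wdist_le hG hw h0 (fun e he => ?_) (fun e he => ?_) ?_ ?_
      (p u v).1 (hp u v) (hhit u v).1 (hhit u v).2).trans (error_le hn hε hδ hδ' hγ hγ')
    · simpa [noiseMean, he] using h1 e
    · simpa [noiseMean, he] using h1 e
    · have := (edgeScale_pos hε).le
      have := Real.log_nonneg (x := (Fintype.card V : ℝ) ^ 2 / γ)
        (by rw [le_div_iff₀ hγ]; nlinarith)
      positivity
    · have := (shortcutScale_pos (Fintype.card_pos (α := V)) hε hδ hδ').le
      have := Real.log_nonneg (x := (Fintype.card V : ℝ) / γ)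
        (by rw [le_div_iff₀ hγ]; nlinarith)
      positivity
  refine le_trans ?_ (measure_mono hsub)
  refine le_trans (tsub_le_tsub_left
    (noiseLaw_exists_lt_abs_sub_le hV₁ hε hδ hδ' hγ hγ') 1) ?_
  rw [tsub_le_iff_left, ← measure_univ (μ := noiseLaw V₁ ε δ γ), ← Set.union_compl_self bad]
  exact measure_union_le _ _

open Classical in
theorem one_sub_le_privateAPSP {G : SimpleGraph V} (hG : G.Connected)
    {w : Sym2 V → ℝ} (hw : ∀ e ∈ G.edgeSet, 0 ≤ w e) {s : ℕ}
    (hs : s = ⌊√(Fintype.card V : ℝ)⌋₊ ∨ s = ⌈√(Fintype.card V : ℝ)⌉₊) {ε δ γ : ℝ} (hε : 0 < ε)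
    (hδ : 0 < δ) (hδ' : δ ≤ 1 / 2) (hγ : 0 < γ) (hγ' : γ < 1) :
    ENNReal.ofReal (1 - 4 * γ) ≤ privateAPSP G s ε δ γ w
      {H | ∀ u v : V, |wdist H.1 H.2 u v - wdist G w u v| ≤
        300 * (ε⁻¹ * √(Fintype.card V : ℝ) * Real.log (Fintype.card V / γ) ^ 2 *
          √(Real.log (1 / δ)))} := by
  have := hG.nonempty
  -- For `γ ≥ 1 / 2` the claim is void; below that `1 - 2γ` is positive, and the product of the two
  -- success probabilities is `(1 - 2γ) ^ 2 ≥ 1 - 4γ`.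
  rcases le_or_gt (1 / 2) γ with hhalf | hhalf
  · rw [ENNReal.ofReal_of_nonpos (by linarith)]
    exact zero_le
  choose p hp using fun u v => exists_path_walkWeight_eq_wdist hG w u v
  set S := {H : WeightedGraph V | ∀ u v : V, |wdist H.1 H.2 u v - wdist G w u v| ≤
        300 * (ε⁻¹ * √(Fintype.card V : ℝ) * Real.log (Fintype.card V / γ) ^ 2 *
          √(Real.log (1 / δ)))}
  simp only [privateAPSP, Measure.smul_apply, Measure.finsetSum_apply, smul_eq_mul]
  set F := (Finset.univ.powersetCard s : Finset (Finset V)) with hF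
  have hFpos : 0 < F.card := by
    rw [hF, Finset.card_powersetCard, Finset.card_univ]
    exact Nat.choose_pos (le_card_of_eq_floor_or_ceil hs)
  have hFpos' : (0 : ℝ) < F.card := by exact_mod_cast hFpos
  set Q : Finset V → Prop := fun V₁ => ∀ u v,
    HitsPrefix V₁ (prefixLength (Fintype.card V) γ) (p u v).1 ∧
      HitsPrefix V₁ (prefixLength (Fintype.card V) γ) (p u v).1.reverse
  have hbad : ((F.filter fun V₁ => ¬Q V₁).card : ℝ) ≤ 2 * γ * F.card :=
    card_filter_not_hitsPrefix_le p hs hγ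
  have hgood : (1 - 2 * γ) * F.card ≤ (F.filter Q).card := by
    have h : ((F.filter Q).card : ℝ) + (F.filter fun V₁ => ¬Q V₁).card = F.card := by
      exact_mod_cast Finset.card_filter_add_card_filter_not Q
    linarith
  calc ENNReal.ofReal (1 - 4 * γ)
      ≤ ENNReal.ofReal ((F.card : ℝ)⁻¹ * ((F.filter Q).card * (1 - 2 * γ))) := by
        refine ENNReal.ofReal_le_ofReal ?_
        rw [inv_mul_eq_div, le_div_iff₀ hFpos']
        nlinarith
    _ = (F.card : ℝ≥0∞)⁻¹ * ∑ V₁ ∈ F.filter Q, (1 - ENNReal.ofReal (2 * γ)) := by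
        rw [Finset.sum_const, nsmul_eq_mul, ENNReal.ofReal_mul (by positivity),
          ENNReal.ofReal_mul (by positivity), ENNReal.ofReal_inv_of_pos hFpos',
          ENNReal.ofReal_natCast, ENNReal.ofReal_natCast,
          ENNReal.ofReal_sub _ (by positivity), ENNReal.ofReal_one]
    _ ≤ (F.card : ℝ≥0∞)⁻¹ * ∑ V₁ ∈ F.filter Q,
          (noiseLaw V₁ ε δ γ).map (syntheticGraph G w V₁) S := by
        gcongr with V₁ hV₁
        obtain ⟨hV, hQ⟩ := Finset.mem_filter.1 hV₁
        -- This inequality holds for arbitrary sets, so measurability of `S` is not needed.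
        refine le_trans ?_ (Measure.le_map_apply (measurable_syntheticGraph G w V₁).aemeasurable S)
        refine one_sub_le_noiseLaw_preimage hG hw ?_ hε hδ hδ' hγ hγ' p hp hQ
        rw [(Finset.mem_powersetCard.1 hV).2]
        exact choose_two_le_of_eq_floor_or_ceil hs
    _ ≤ _ := by
        gcongr
        exact Finset.filter_subset _ _

end SimpleGraph

theorem mainTheorem1 :
    ∃ C : ℝ, 0 < C ∧
      ∀ (V : Type*) [Fintype V] (G : SimpleGraph V), G.Connected →
      ∀ s : ℕ, (s = ⌊√(Fintype.card V : ℝ)⌋₊ ∨ s = ⌈√(Fintype.card V : ℝ)⌉₊) →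
      ∀ ε δ γ : ℝ, 0 < ε → 0 < δ → δ ≤ 1 / 2 → 0 < γ → γ < 1 →
        (ε < 2 → SimpleGraph.IsDP G ε δ (SimpleGraph.privateAPSP G s ε δ γ)) ∧
        ∀ w : Sym2 V → ℝ, (∀ e ∈ G.edgeSet, 0 ≤ w e) →
          ENNReal.ofReal (1 - 4 * γ) ≤
            SimpleGraph.privateAPSP G s ε δ γ w
              {H | ∀ u v : V,
                |SimpleGraph.wdist H.1 H.2 u v - SimpleGraph.wdist G w u v| ≤
                  C * (ε⁻¹ * √(Fintype.card V : ℝ) *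
                    Real.log (Fintype.card V / γ) ^ 2 * √(Real.log (1 / δ)))} := by
  refine ⟨300, by norm_num, fun V _ G hG s hs ε δ γ hε hδ hδ' hγ hγ' => ⟨fun hε' => ?_,
    fun w hw => SimpleGraph.one_sub_le_privateAPSP hG hw hs hε hδ hδ' hγ hγ'⟩⟩
  exact SimpleGraph.isDP_privateAPSP hG (SimpleGraph.choose_two_le_of_eq_floor_or_ceil hs)
    hε hε' hδ hδ' γ
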